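/- Let $0<\beta\le 1<\alpha\le 2$ and $a\in\mathbb R$. For $\nu>0$ let $(\Delta^{-\nu}y)(\nu+n)=\frac1{\Gamma(\nu)}\sum_{s=0}^{n}\frac{\Gamma(n-s+\nu)}{\Gamma(n-s+1)}\,y(s)$, $n\in\mathbb N_0$, let $\Delta^{0}y=y$, and for $\mu>0$, $m=\lceil\mu\rceil$, let $\Delta^{\mu}x=\Delta^{-(m-\mu)}(\Delta^{m}x)$ be the Caputo-like difference. For $b\in\mathbb C$ consider, for $x:\mathbb N_0\to\mathbb C$, $$\Delta^{\alpha}x(t)+a\,\Delta^{\beta}x(t+\alpha-\beta-1)=(b-1)\,x(t+\alpha-2),\qquad t\in\{2-\alpha,3-\alpha,\dots\}.\tag{E}$$ The zero solution of (E) is called asymptotically stable if it is Lyapunov stable with respect to the initial values $(x(0),x(1))$ and every solution tends to $0$. Put $F(z)=z^2(1-z^{-1})^{\alpha}+a\,z(1-z^{-1})^{\beta}+1$ (principal powers). 1. Let $x$ be a solution of (E). Then $X(z)=\sum_{n\ge0}x(n)z^{-n}$ converges absolutely for all sufficiently large $|z|$, and for every $z$ with $|z|>1$ at which it converges absolutely,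 $$\bigl(F(z)-b\bigr)X(z)=\Bigl[z(z-2)\bigl(\tfrac{z}{z-1}\bigr)^{2-\alpha}+a z\bigl(\tfrac{z}{z-1}\bigr)^{1-\beta}\Bigr]x(0)+z\bigl(\tfrac{z}{z-1}\bigr)^{2-\alpha}x(1).$$ Equating the coefficient of $X(z)$ to zero gives the characteristic equation $F(z)=b$. 2. For every $b\in\mathbb C$, the zero solution of (E) is asymptotically stable if and only if every root $z\ne0$ of the characteristic equation $F(z)=b$ satisfies $|z|<1$. 3. For $\theta\in[0,2\pi]$, $$F(e^{i\theta})=2^{\alpha}\bigl(\sin\tfrac\theta2\bigr)^{\alpha}e^{i[\frac{\alpha\pi}2+\theta(2-\frac\alpha2)]}+a\,2^{\beta}\bigl(\sin\tfrac\theta2\bigr)^{\beta}e^{i[\frac{\beta\pi}2+\theta(1-\frac\beta2)]}+1,$$ with real and imaginary parts $$\gamma_1(\theta)=2^{\alpha}\bigl(\sin\tfrac\theta2\bigr)^{\alpha}\cos\bigl(\tfrac{\alpha\pi}2+\theta(2-\tfrac\alpha2)\bigr)+a\,2^{\beta}\bigl(\sin\tfrac\theta2\bigr)^{\beta}\cos\bigl(\tfrac{\beta\pi}2+\theta(1-\tfrac\beta2)\bigr)+1,$$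 $$\gamma_2(\theta)=2^{\alpha}\bigl(\sin\tfrac\theta2\bigr)^{\alpha}\sin\bigl(\tfrac{\alpha\pi}2+\theta(2-\tfrac\alpha2)\bigr)+a\,2^{\beta}\bigl(\sin\tfrac\theta2\bigr)^{\beta}\sin\bigl(\tfrac{\beta\pi}2+\theta(1-\tfrac\beta2)\bigr).$$ 4. Let $\gamma(\theta)=\gamma_1(\theta)+i\gamma_2(\theta)$, $\theta\in[0,2\pi]$. Then $\gamma(0)=\gamma(2\pi)$, the topological boundary of the set of all $b\in\mathbb C$ for which the zero solution of (E) is asymptotically stable is contained in the image of $\gamma$, and, for every $b\in\mathbb C$, the zero solution of (E) is asymptotically stable if and only if $b$ lies in the inner region of the (in general self-intersecting) closed curve $\gamma$, that is, $b$ does not lie on $\gamma$ and $\gamma$ winds around $b$ exactly twice in the positive sense. -/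

import Mathlib

namespace TwoTermFracDiff

/-- The fractional sum `(Δ^{-ν} y)(t)` of order `ν ≥ 0` at the grid point `t = ν + n`.
For `ν > 0` it is `(1 / Γ(ν)) ∑_{s=0}^{n} Γ(n - s + ν) / Γ(n - s + 1) y(s)`; the sum of
order `0` is the identity. -/
noncomputable def fracSum (ν : ℝ) (y : ℕ → ℂ) (n : ℕ) : ℂ :=
  if ν = 0 then y n
  else ((1 / Real.Gamma ν : ℝ) : ℂ) * ∑ s ∈ Finset.range (n + 1),
    ((Real.Gamma ((n : ℝ) - (s : ℝ) + ν) / Real.Gamma ((n : ℝ) - (s : ℝ) + 1) : ℝ) : ℂ) * y s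

/-- The Caputo-like difference `Δ^μ x = Δ^{-(m - μ)} (Δ^m x)` of order `μ > 0`, `m = ⌈μ⌉`,
at the grid point `t = (m - μ) + n`. For integer `μ` it is the ordinary difference `Δ^m x (n)`. -/
noncomputable def caputoDiff (μ : ℝ) (x : ℕ → ℂ) (n : ℕ) : ℂ :=
  fracSum ((⌈μ⌉₊ : ℝ) - μ) ((fwdDiff 1)^[⌈μ⌉₊] x) n

/-- `x` solves `Δ^α x(t) + a Δ^β x(t + α - β - 1) = (b - 1) x(t + α - 2)` for all
`t = (2 - α) + n`, `n ∈ ℕ`. Here `t + α - β - 1 = (1 - β) + n` is the `n`-th grid point of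
`Δ^β` (as `⌈β⌉ = 1`), and `t + α - 2 = n`. -/
def IsSolution (α β a : ℝ) (b : ℂ) (x : ℕ → ℂ) : Prop :=
  ∀ n : ℕ, caputoDiff α x n + (a : ℂ) * caputoDiff β x n = (b - 1) * x n

/-- Asymptotic stability of the zero solution: it is Lyapunov stable with respect to the initial
values `x(0)`, `x(1)`, and every solution tends to zero (the equation is linear). -/
def AsymptoticallyStable (α β a : ℝ) (b : ℂ) : Prop :=
  (∀ ε > 0, ∃ δ > 0, ∀ x : ℕ → ℂ, IsSolution α β a b x → ‖x 0‖ < δ → ‖x 1‖ < δ →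
    ∀ n, ‖x n‖ < ε) ∧
  ∀ x : ℕ → ℂ, IsSolution α β a b x → Filter.Tendsto x Filter.atTop (nhds 0)

/-- The Z-transform `∑ x(n) z^{-n}`, meaningful where the series converges absolutely. -/
noncomputable def zTransform (x : ℕ → ℂ) (z : ℂ) : ℂ := ∑' n : ℕ, x n * (z⁻¹) ^ n

/-- The left-hand side `z² (1 - z⁻¹)^α + a z (1 - z⁻¹)^β + 1` of the characteristic equation,
with principal powers; the characteristic equation is `charFun α β a z = b`. -/
noncomputable def charFun (α β a : ℝ) (z : ℂ) : ℂ :=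
  z ^ 2 * (1 - z⁻¹) ^ (α : ℂ) + (a : ℂ) * z * (1 - z⁻¹) ^ (β : ℂ) + 1

/-- The first coordinate `γ₁(θ)` of the boundary curve. -/
noncomputable def boundaryRe (α β a θ : ℝ) : ℝ :=
  2 ^ α * Real.sin (θ / 2) ^ α * Real.cos (α * Real.pi / 2 + θ * (2 - α / 2)) +
    a * 2 ^ β * Real.sin (θ / 2) ^ β * Real.cos (β * Real.pi / 2 + θ * (1 - β / 2)) + 1

/-- The second coordinate `γ₂(θ)` of the boundary curve. -/
noncomputable def boundaryIm (α β a θ : ℝ) : ℝ :=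
  2 ^ α * Real.sin (θ / 2) ^ α * Real.sin (α * Real.pi / 2 + θ * (2 - α / 2)) +
    a * 2 ^ β * Real.sin (θ / 2) ^ β * Real.sin (β * Real.pi / 2 + θ * (1 - β / 2))

/-- The boundary curve `γ(θ) = (γ₁(θ), γ₂(θ))`, `0 ≤ θ ≤ 2π`, in the complex plane. -/
noncomputable def boundaryCurve (α β a θ : ℝ) : ℂ :=
  ⟨boundaryRe α β a θ, boundaryIm α β a θ⟩

/-- The closed curve `c` on `[0, 2π]` avoids `b` and winds `k` times (counterclockwise positive)
around `b`: a continuous choice of the argument of `c(θ) - b` increases by `2πk`. -/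
def HasWindingNumber (c : ℝ → ℂ) (b : ℂ) (k : ℤ) : Prop :=
  (∀ θ ∈ Set.Icc 0 (2 * Real.pi), c θ ≠ b) ∧
  ∃ φ : ℝ → ℝ, ContinuousOn φ (Set.Icc 0 (2 * Real.pi)) ∧
    (∀ θ ∈ Set.Icc 0 (2 * Real.pi),
      c θ - b = (‖c θ - b‖ : ℂ) * Complex.exp ((φ θ : ℂ) * Complex.I)) ∧
    φ (2 * Real.pi) - φ 0 = 2 * Real.pi * k

end TwoTermFracDiff

/-! A fractional sum of order `ν` is multiplication of generating series by `(1 - X)^(-ν)`. So `x`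
solves the equation exactly when its generating series `f` satisfies `P * f = R` (`isSolution_iff`).
Here `P = charSeries` has the values `w² (F(1/w) - b)` with `w = 1/z`, and `R = dataSeries` carries
the initial values. The coefficients of `P` are absolutely summable because `α` and `β` are
positive; those of `R` tend to zero because the exponents `α - 2` and `β - 1` exceed `-1`.

If `P` has no zero in the closed unit disk, Wiener's lemma gives an inverse of `P` with summable
coefficients. Convolving it with the null sequence `R` gives a null sequence depending linearly on
the initial values, which is asymptotic stability. Conversely, let `P` vanish at `w` in the closed
disk. If `w = 1`, then `b = 1` and constants are solutions. Otherwise take initial values `(0, 1)`: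
were this solution null, `(1 - r) f(r w)` would tend to zero as `r` increases to `1`. Since `P(r w)
= O(1 - r)`, also `R(r w)` would tend to zero, but its limit is `w (1 - w)^(α - 2)`, which is
nonzero.

For the curve, `P` is a uniform limit of polynomials on the closed disk, so the polynomial argument
principle and a Rouché argument show that `P` is zero-free there iff it has winding number zero on
the unit circle (`hasWindingNumber_zero_iff_ne_zero`). At `z = e^(iθ)` the factor `w² = e^(-2iθ)`
accounts for two turns, whence winding number two for the boundary curve. The frontier claim is
local constancy of the winding number off the curve. -/

/-! ### Wiener's lemma for absolutely summable power series -/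

section WienerSeries

open PowerSeries Finset Filter Topology

/-- The subalgebra of power series with absolutely summable coefficients. -/
noncomputable def wienerSubalgebra : Subalgebra ℂ ℂ⟦X⟧ where
  carrier := {f | Summable fun n => ‖coeff n f‖}
  mul_mem' {f g} hf hg := by
    simpa only [Set.mem_ofPred_eq, coeff_mul] using
      summable_norm_sum_mul_antidiagonal_of_summable_norm hf hg
  add_mem' {f g} hf hg :=
    Summable.of_nonneg_of_le (fun _ => norm_nonneg _)
      (fun n => by simpa using norm_add_le (coeff n f) (coeff n g)) (hf.add hg)
  algebraMap_mem' r := by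
    refine summable_of_ne_finset_zero (s := {0}) fun n hn => ?_
    rw [PowerSeries.algebraMap_apply, coeff_C, if_neg (by simpa using hn), norm_zero]

theorem mem_wienerSubalgebra {f : ℂ⟦X⟧} :
    f ∈ wienerSubalgebra ↔ Summable fun n => ‖coeff n f‖ := Iff.rfl

theorem X_pow_mem_wienerSubalgebra (k : ℕ) : (X : ℂ⟦X⟧) ^ k ∈ wienerSubalgebra := by
  refine pow_mem (summable_of_ne_finset_zero (s := {1}) fun n hn => ?_) k
  rw [coeff_X, if_neg (by simpa using hn), norm_zero]

theorem X_mem_wienerSubalgebra : (X : ℂ⟦X⟧) ∈ wienerSubalgebra := by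
  simpa using X_pow_mem_wienerSubalgebra 1

/-- The value at `w` of a power series, meaningful where the series converges. -/
noncomputable def seriesEval (f : ℂ⟦X⟧) (w : ℂ) : ℂ := ∑' n, coeff n f * w ^ n

theorem seriesEval_mul {f g : ℂ⟦X⟧} {w : ℂ} (hf : Summable fun n => ‖coeff n f * w ^ n‖)
    (hg : Summable fun n => ‖coeff n g * w ^ n‖) :
    seriesEval (f * g) w = seriesEval f w * seriesEval g w := by
  rw [seriesEval, seriesEval, seriesEval,
    tsum_mul_tsum_eq_tsum_sum_antidiagonal_of_summable_norm hf hg]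
  refine tsum_congr fun n => ?_
  rw [coeff_mul, sum_mul]
  refine sum_congr rfl fun p hp => ?_
  rw [← mem_antidiagonal.mp hp, pow_add]
  ring

theorem summable_norm_coeff_mul_pow {f : ℂ⟦X⟧} (hf : f ∈ wienerSubalgebra) {w : ℂ}
    (hw : ‖w‖ ≤ 1) : Summable fun n => ‖coeff n f * w ^ n‖ := by
  refine Summable.of_nonneg_of_le (fun _ => norm_nonneg _) (fun n => ?_) hf
  rw [norm_mul, norm_pow]
  exact mul_le_of_le_one_right (norm_nonneg _) (pow_le_one₀ (norm_nonneg _) hw)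

theorem continuousOn_seriesEval {f : ℂ⟦X⟧} (hf : f ∈ wienerSubalgebra) :
    ContinuousOn (seriesEval f) (Metric.closedBall 0 1) := by
  refine continuousOn_tsum (fun n => by fun_prop) hf fun n w hw => ?_
  rw [norm_mul, norm_pow]
  exact mul_le_of_le_one_right (norm_nonneg _)
    (pow_le_one₀ (norm_nonneg _) (by simpa using hw))

namespace WienerAlgebra

/-- The `ℓ¹` norm of coefficients as a ring norm. -/
noncomputable def ringNorm : RingNorm wienerSubalgebra where
  toFun f := ∑' n, ‖coeff n (f : ℂ⟦X⟧)‖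
  map_zero' := by simp
  add_le' f g := by
    rw [← f.2.tsum_add g.2]
    exact (f + g).2.tsum_le_tsum (fun n => by simpa using norm_add_le _ _) (f.2.add g.2)
  neg' f := by simp
  mul_le' f g := by
    have hf : Summable fun n => ‖(‖coeff n (f : ℂ⟦X⟧)‖ : ℝ)‖ := by
      simpa using mem_wienerSubalgebra.mp f.2
    have hg : Summable fun n => ‖(‖coeff n (g : ℂ⟦X⟧)‖ : ℝ)‖ := by
      simpa using mem_wienerSubalgebra.mp g.2
    rw [tsum_mul_tsum_eq_tsum_sum_antidiagonal_of_summable_norm hf hg]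
    refine (f * g).2.tsum_le_tsum (fun n => ?_)
      (summable_norm_sum_mul_antidiagonal_of_summable_norm hf hg).of_norm
    simp only [MulMemClass.coe_mul, coeff_mul]
    exact (norm_sum_le _ _).trans (le_of_eq (sum_congr rfl fun p _ => norm_mul _ _))
  eq_zero_of_map_eq_zero' f hf := by
    ext n
    have h := f.2.le_tsum n fun _ _ => norm_nonneg _
    rw [show ∑' n, ‖coeff n (f : ℂ⟦X⟧)‖ = 0 from hf] at h
    simpa using h

noncomputable instance : NormedCommRing wienerSubalgebra :=
  { ringNorm.toNormedRing with
    mul_comm := mul_comm }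

theorem norm_def (f : wienerSubalgebra) : ‖f‖ = ∑' n, ‖coeff n (f : ℂ⟦X⟧)‖ := rfl

theorem norm_coeff_le (f : wienerSubalgebra) (n : ℕ) : ‖coeff n (f : ℂ⟦X⟧)‖ ≤ ‖f‖ :=
  f.2.le_tsum n fun _ _ => norm_nonneg _

noncomputable instance : NormedAlgebra ℂ wienerSubalgebra where
  norm_smul_le c f := by
    rw [norm_def, norm_def]
    simp [tsum_mul_left]

/-- The coefficient sequence as an element of `ℓ¹`. -/
noncomputable def toLp (f : wienerSubalgebra) : lp (fun _ : ℕ => ℂ) 1 :=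
  ⟨fun n => coeff n (f : ℂ⟦X⟧), memℓp_gen (by simpa using mem_wienerSubalgebra.mp f.2)⟩

theorem isometry_toLp : Isometry toLp := by
  refine Isometry.of_dist_eq fun f g => ?_
  rw [dist_eq_norm, dist_eq_norm, lp.norm_eq_tsum_rpow (by simp), norm_def]
  simp only [ENNReal.toReal_one, Real.rpow_one, div_one]
  exact tsum_congr fun n => rfl

theorem surjective_toLp : Function.Surjective toLp := by
  intro u
  have hu : Summable fun n => ‖u n‖ := by simpa using (memℓp_gen_iff (by simp)).mp u.2
  refine ⟨⟨PowerSeries.mk u, by simpa [mem_wienerSubalgebra] using hu⟩, ?_⟩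
  ext n
  simp [toLp]

/-- Completeness is carried over from `ℓ¹`; Gelfand theory needs a Banach algebra. -/
instance : CompleteSpace wienerSubalgebra :=
  (IsometryEquiv.mk (Equiv.ofBijective toLp ⟨isometry_toLp.injective, surjective_toLp⟩)
    isometry_toLp).completeSpace

theorem continuous_coeff (m : ℕ) :
    Continuous fun f : wienerSubalgebra => coeff m (f : ℂ⟦X⟧) := by
  refine LipschitzWith.continuous (K := 1) (LipschitzWith.of_dist_le_mul fun f g => ?_)
  simpa [dist_eq_norm] using norm_coeff_le (f - g) m

/-- The indeterminate as an element of the algebra. -/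
noncomputable def var : wienerSubalgebra := ⟨X, X_mem_wienerSubalgebra⟩

theorem norm_var_pow (k : ℕ) : ‖var ^ k‖ = 1 := by
  rw [norm_def, tsum_eq_single k]
  · simp [var, coeff_X_pow]
  · intro n hn
    simp [var, coeff_X_pow, hn]

theorem norm_one_eq : ‖(1 : wienerSubalgebra)‖ = 1 := by
  simpa using norm_var_pow 0

theorem hasSum_smul_var_pow (f : wienerSubalgebra) :
    HasSum (fun n => coeff n (f : ℂ⟦X⟧) • var ^ n) f := by
  have hs : Summable fun n => coeff n (f : ℂ⟦X⟧) • var ^ n := by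
    refine Summable.of_norm_bounded (mem_wienerSubalgebra.mp f.2) fun n => ?_
    rw [norm_smul, norm_var_pow, mul_one]
  obtain ⟨g, hg⟩ := hs
  -- The sum `g` must be `f`: coefficient functionals are continuous, and each sees only one term of
  -- the series.
  convert hg
  ext m
  have h1 := (hg.map (AddMonoidHom.mk' (fun f : wienerSubalgebra => coeff m (f : ℂ⟦X⟧))
    (fun a b => by simp)) (continuous_coeff m)).unique (hasSum_single m fun n hn => by
      simp [var, coeff_X_pow, hn.symm])
  simpa [var, coeff_X_pow] using h1.symm

/-- A character is continuous, hence determined by its value at `var`; that value lies in the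
spectrum of an element of norm one. Thus every character is evaluation at a point of the closed
disk. -/
theorem character_eq_seriesEval (φ : WeakDual.characterSpace ℂ wienerSubalgebra)
    (f : wienerSubalgebra) : ‖φ var‖ ≤ 1 ∧ φ f = seriesEval f (φ var) := by
  constructor
  · have h := spectrum.norm_le_norm_mul_of_mem (WeakDual.CharacterSpace.apply_mem_spectrum φ var)
    have h1 := norm_var_pow 1
    rw [pow_one] at h1
    rwa [norm_one_eq, h1, mul_one] at h
  · have h := (hasSum_smul_var_pow f).map φ (map_continuous φ)
    rw [← h.tsum_eq]
    exact tsum_congr fun n => by simp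

end WienerAlgebra

/-- Wiener's lemma: a power series with absolutely summable coefficients and without zeros in the
closed unit disk has an inverse with absolutely summable coefficients. -/
theorem exists_mul_eq_one_of_seriesEval_ne_zero {f : ℂ⟦X⟧} (hf : f ∈ wienerSubalgebra)
    (h : ∀ w : ℂ, ‖w‖ ≤ 1 → seriesEval f w ≠ 0) : ∃ g ∈ wienerSubalgebra, f * g = 1 := by
  have hu : IsUnit (⟨f, hf⟩ : wienerSubalgebra) := by
    -- A nonunit of a commutative complex Banach algebra is killed by some character, which here
    -- produces a zero in the closed disk.
    by_contra hn
    obtain ⟨φ, hφ⟩ := WeakDual.CharacterSpace.exists_apply_eq_zero hn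
    obtain ⟨h1, h2⟩ := WienerAlgebra.character_eq_seriesEval φ ⟨f, hf⟩
    exact h _ h1 (h2.symm.trans hφ)
  obtain ⟨g, hg⟩ := hu.exists_right_inv
  exact ⟨g, g.2, congrArg Subtype.val hg⟩

theorem tendsto_coeff_mul {f g : ℂ⟦X⟧} (hf : f ∈ wienerSubalgebra)
    (hg : Tendsto (fun n => coeff n g) atTop (𝓝 0)) :
    Tendsto (fun n => coeff n (f * g)) atTop (𝓝 0) := by
  obtain ⟨M, hM⟩ := (Metric.isBounded_range_of_tendsto _ hg).exists_norm_le
  -- Extending the convolution by zero to all `k` lets dominated convergence act termwise.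
  have key : Tendsto (fun n => ∑' k, if k ≤ n then coeff k f * coeff (n - k) g else 0) atTop
      (𝓝 (∑' _ : ℕ, (0 : ℂ))) := by
    refine tendsto_tsum_of_dominated_convergence (bound := fun k => ‖coeff k f‖ * M)
      (hf.mul_right M) (fun k => ?_) (Eventually.of_forall fun n k => ?_)
    · have h1 : Tendsto (fun n => coeff k f * coeff (n - k) g) atTop (𝓝 (coeff k f * 0)) :=
        (hg.comp (tendsto_sub_atTop_nat k)).const_mul _
      rw [mul_zero] at h1
      refine h1.congr' ?_
      filter_upwards [eventually_ge_atTop k] with n hn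
      rw [if_pos hn]
    · have hM' := hM _ ⟨n - k, rfl⟩
      split_ifs
      · rw [norm_mul]
        exact mul_le_mul_of_nonneg_left hM' (norm_nonneg _)
      · rw [norm_zero]
        exact mul_nonneg (norm_nonneg _) ((norm_nonneg _).trans hM')
  rw [tsum_zero] at key
  refine key.congr fun n => ?_
  rw [coeff_mul, Nat.sum_antidiagonal_eq_sum_range_succ fun i j => coeff i f * coeff j g,
    tsum_eq_sum (s := range n.succ)]
  · exact sum_congr rfl fun k hk => if_pos (Nat.lt_succ_iff.mp (mem_range.mp hk))
  · intro k hk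
    exact if_neg fun h => hk (mem_range.mpr (Nat.lt_succ_of_le h))

end WienerSeries

/-! ### The binomial series on the closed unit disk -/

section BinomialSeries

open PowerSeries Finset Filter Topology

/-- The coefficients of the binomial series `(1 - w)^γ`. -/
noncomputable def binomCoeff (γ : ℝ) (n : ℕ) : ℝ := (-1) ^ n * Ring.choose γ n

/-- The binomial series `(1 - X)^γ`. -/
noncomputable def oneSubPow (γ : ℝ) : ℂ⟦X⟧ := rescale (-1) (binomialSeries ℂ γ)

@[simp]
theorem coeff_oneSubPow (γ : ℝ) (n : ℕ) : coeff n (oneSubPow γ) = (binomCoeff γ n : ℂ) := by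
  simp [oneSubPow, binomCoeff]

theorem oneSubPow_add (γ δ : ℝ) : oneSubPow (γ + δ) = oneSubPow γ * oneSubPow δ := by
  simp [oneSubPow]

theorem oneSubPow_one : oneSubPow 1 = 1 - X := by
  have h := binomialSeries_nat (R := ℝ) (A := ℂ) 1
  rw [Nat.cast_one, pow_one] at h
  rw [oneSubPow, h]
  simp [rescale_X, sub_eq_add_neg]

theorem oneSubPow_zero : oneSubPow 0 = 1 := by simp [oneSubPow]

@[simp]
theorem binomCoeff_zero (γ : ℝ) : binomCoeff γ 0 = 1 := by simp [binomCoeff]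

@[simp]
theorem constantCoeff_oneSubPow (γ : ℝ) : constantCoeff (oneSubPow γ) = 1 := by
  rw [← coeff_zero_eq_constantCoeff_apply, coeff_oneSubPow, binomCoeff_zero, Complex.ofReal_one]

theorem binomCoeff_succ (γ : ℝ) (n : ℕ) :
    binomCoeff γ (n + 1) = binomCoeff γ n * ((n - γ) / (n + 1)) := by
  have hn : (n : ℝ) + 1 ≠ 0 := by positivity
  have hf : (n.factorial : ℝ) ≠ 0 := by positivity
  rw [binomCoeff, binomCoeff, Ring.choose_eq_smul, Ring.choose_eq_smul, descPochhammer_succ_right,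
    Polynomial.smeval_mul, Nat.factorial_succ]
  simp [Polynomial.smeval_sub, Polynomial.smeval_natCast]
  field_simp
  ring

theorem binomCoeff_one (γ : ℝ) : binomCoeff γ 1 = -γ := by
  simpa using binomCoeff_succ γ 0

/-- Both sides satisfy the same ratio recursion. This identifies the kernel of the fractional sum
with a binomial series. -/
theorem binomCoeff_neg_eq_gamma {ν : ℝ} (hν : 0 < ν) (n : ℕ) :
    binomCoeff (-ν) n = 1 / Real.Gamma ν * (Real.Gamma (n + ν) / Real.Gamma (n + 1)) := by
  have hG := (Real.Gamma_pos_of_pos hν).ne'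
  induction n with
  | zero => simp [hG]
  | succ n ih =>
    have h1 : Real.Gamma ((n + 1 : ℕ) + ν) = (n + ν) * Real.Gamma (n + ν) := by
      rw [← Real.Gamma_add_one (by positivity)]
      push_cast
      ring_nf
    have h2 : Real.Gamma ((n + 1 : ℕ) + 1) = (n + 1) * Real.Gamma (n + 1) := by
      rw [← Real.Gamma_add_one (by positivity)]
      push_cast
      rfl
    rw [binomCoeff_succ, ih, h1, h2]
    have h3 : Real.Gamma ((n : ℝ) + 1) ≠ 0 := (Real.Gamma_pos_of_pos (by positivity)).ne'
    field_simp
    ring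

theorem binomCoeff_nonneg {γ : ℝ} (hγ : γ ≤ 0) (n : ℕ) : 0 ≤ binomCoeff γ n := by
  induction n with
  | zero => simp
  | succ n ih =>
    rw [binomCoeff_succ]
    have : (0 : ℝ) ≤ n := n.cast_nonneg
    exact mul_nonneg ih (div_nonneg (by linarith) (by linarith))

theorem binomCoeff_succ_nonpos {γ : ℝ} (hγ0 : 0 ≤ γ) (hγ1 : γ ≤ 1) (n : ℕ) :
    binomCoeff γ (n + 1) ≤ 0 := by
  induction n with
  | zero => simpa [binomCoeff_one] using hγ0
  | succ n ih =>
    rw [binomCoeff_succ]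
    have : (0 : ℝ) ≤ n := n.cast_nonneg
    push_cast
    exact mul_nonpos_of_nonpos_of_nonneg ih (div_nonneg (by linarith) (by linarith))

/-- Taking partial sums is division by `1 - X`, which lowers the exponent by one. -/
theorem sum_range_binomCoeff (γ : ℝ) (n : ℕ) :
    ∑ k ∈ range (n + 1), binomCoeff γ k = binomCoeff (γ - 1) n := by
  induction n with
  | zero => simp
  | succ n ih =>
    rw [sum_range_succ, ih, binomCoeff_succ]
    have h : oneSubPow γ = (1 - X) * oneSubPow (γ - 1) := by
      rw [← oneSubPow_one, ← oneSubPow_add, add_sub_cancel]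
    have h1 := congrArg (coeff (n + 1)) h
    rw [sub_mul, one_mul, map_sub, coeff_succ_X_mul, coeff_oneSubPow, coeff_oneSubPow,
      coeff_oneSubPow] at h1
    have h2 : binomCoeff γ (n + 1) = binomCoeff (γ - 1) (n + 1) - binomCoeff (γ - 1) n := by
      exact_mod_cast h1
    rw [binomCoeff_succ, binomCoeff_succ] at h2
    rw [h2, binomCoeff_succ]
    ring

/-- All coefficients after the zeroth are nonpositive, so sums of their absolute values are `1`
minus a nonnegative binomial coefficient. -/
theorem oneSubPow_mem_wienerSubalgebra_of_le_one {γ : ℝ} (hγ0 : 0 ≤ γ) (hγ1 : γ ≤ 1) :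
    oneSubPow γ ∈ wienerSubalgebra := by
  rw [mem_wienerSubalgebra, ← summable_nat_add_iff 1]
  refine summable_of_sum_range_le (c := 1) (fun _ => norm_nonneg _) fun n => ?_
  have h1 : ∑ i ∈ range n, ‖coeff (i + 1) (oneSubPow γ)‖ = 1 - binomCoeff (γ - 1) n := by
    rw [← sum_range_binomCoeff, sum_range_succ', binomCoeff_zero, sub_add_cancel_right,
      ← sum_neg_distrib]
    refine sum_congr rfl fun i _ => ?_
    rw [coeff_oneSubPow, Complex.norm_real, Real.norm_eq_abs,
      abs_of_nonpos (binomCoeff_succ_nonpos hγ0 hγ1 i)]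
  rw [h1]
  linarith [binomCoeff_nonneg (show γ - 1 ≤ 0 by linarith) n]

theorem oneSubPow_mem_wienerSubalgebra {γ : ℝ} (hγ0 : 0 ≤ γ) (hγ2 : γ ≤ 2) :
    oneSubPow γ ∈ wienerSubalgebra := by
  rcases le_total γ 1 with h | h
  · exact oneSubPow_mem_wienerSubalgebra_of_le_one hγ0 h
  · rw [← add_sub_cancel 1 γ, oneSubPow_add]
    exact mul_mem (oneSubPow_mem_wienerSubalgebra_of_le_one zero_le_one le_rfl)
      (oneSubPow_mem_wienerSubalgebra_of_le_one (by linarith) (by linarith))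

theorem hasSum_oneSubPow (γ : ℝ) {w : ℂ} (hw : ‖w‖ < 1) :
    HasSum (fun n => coeff n (oneSubPow γ) * w ^ n) ((1 - w) ^ (γ : ℂ)) := by
  have h := (Complex.one_add_cpow_hasFPowerSeriesOnBall_zero (a := (γ : ℂ))).hasSum (y := -w)
    (by simpa [enorm_eq_nnnorm, ← NNReal.coe_lt_coe] using hw)
  rw [zero_add, ← sub_eq_add_neg] at h
  have e : (fun n => coeff n (oneSubPow γ) * w ^ n) =
      fun n => (_root_.binomialSeries ℂ (γ : ℂ) n) fun _ => -w := by
    ext n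
    rw [_root_.binomialSeries_apply]
    simp [binomCoeff, neg_pow w, Complex.ofReal_choose]
    ring
  rw [e]
  exact h

theorem one_sub_mem_slitPlane {w : ℂ} (hw : ‖w‖ ≤ 1) (h1 : w ≠ 1) : 1 - w ∈ Complex.slitPlane := by
  rw [Complex.mem_slitPlane_iff]
  by_cases h : w.im = 0
  · left
    have h2 : w.re ≤ 1 := (Complex.re_le_norm w).trans hw
    have h3 : w.re ≠ 1 := fun h3 => h1 (Complex.ext h3 h)
    simpa using lt_of_le_of_ne h2 h3
  · right
    simpa using h

/-- Only at `w = 1` does the base leave the slit plane; there it is zero, and a positive exponent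
keeps the power continuous. -/
theorem continuousOn_one_sub_cpow {γ : ℝ} (hγ : 0 < γ) :
    ContinuousOn (fun w : ℂ => (1 - w) ^ (γ : ℂ)) (Metric.closedBall 0 1) := by
  intro w hw
  refine ContinuousAt.continuousWithinAt ?_
  rcases eq_or_ne w 1 with rfl | h1
  · refine ContinuousAt.comp (g := fun u : ℂ => u ^ (γ : ℂ)) ?_ (by fun_prop)
    rw [sub_self]
    exact Complex.continuousAt_cpow_const_of_re_pos (by simp) (by simpa using hγ)
  · exact ContinuousAt.cpow (by fun_prop) continuousAt_const (one_sub_mem_slitPlane (by simpa using hw) h1)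

/-- Both sides are continuous on the closed disk and agree on the open one. -/
theorem seriesEval_oneSubPow {γ : ℝ} (hγ0 : 0 < γ) (hγ2 : γ ≤ 2) {w : ℂ} (hw : ‖w‖ ≤ 1) :
    seriesEval (oneSubPow γ) w = (1 - w) ^ (γ : ℂ) := by
  have h : Set.EqOn (seriesEval (oneSubPow γ)) (fun w => (1 - w) ^ (γ : ℂ))
      (Metric.ball 0 1) := fun w hw => (hasSum_oneSubPow γ (by simpa using hw)).tsum_eq
  refine h.of_subset_closure
    (continuousOn_seriesEval (oneSubPow_mem_wienerSubalgebra hγ0.le hγ2))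
    (continuousOn_one_sub_cpow hγ0) Metric.ball_subset_closedBall ?_ (by simpa using hw)
  rw [closure_ball _ one_ne_zero]

/-- These coefficients are the partial sums of `(1 - w)^(γ + 1)` at `w = 1`, a convergent series
with sum `0^(γ + 1) = 0`. No Gamma asymptotics are needed. -/
theorem tendsto_coeff_oneSubPow {γ : ℝ} (h1 : -1 < γ) (h2 : γ ≤ 0) :
    Tendsto (fun n => coeff n (oneSubPow γ)) atTop (𝓝 0) := by
  have hm := oneSubPow_mem_wienerSubalgebra (γ := γ + 1) (by linarith) (by linarith)
  have h := ((summable_norm_coeff_mul_pow hm (w := 1) (by simp)).of_norm).hasSum.tendsto_sum_nat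
  have h0 : ∑' n, coeff n (oneSubPow (γ + 1)) * 1 ^ n = 0 := by
    rw [← seriesEval, seriesEval_oneSubPow (by linarith) (by linarith) (by simp), sub_self,
      Complex.zero_cpow]
    exact_mod_cast (show γ + 1 ≠ 0 by linarith)
  rw [h0, ← tendsto_add_atTop_iff_nat 1] at h
  refine h.congr fun n => ?_
  have h3 := sum_range_binomCoeff (γ + 1) n
  rw [add_sub_cancel_right] at h3
  simp only [coeff_oneSubPow, one_pow, mul_one]
  exact_mod_cast h3

end BinomialSeries

/-! ### The difference equation as a power series identity -/

section Transform

open PowerSeries Finset Filter Topology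

namespace TwoTermFracDiff

theorem fracSum_eq_coeff {ν : ℝ} (hν : 0 ≤ ν) (y : ℕ → ℂ) (n : ℕ) :
    fracSum ν y n = coeff n (oneSubPow (-ν) * PowerSeries.mk y) := by
  rcases hν.eq_or_lt with rfl | hν
  · simp [fracSum, oneSubPow_zero]
  · rw [fracSum, if_neg hν.ne', mul_comm (oneSubPow (-ν)), coeff_mul,
      Nat.sum_antidiagonal_eq_sum_range_succ
        fun i j => coeff i (PowerSeries.mk y) * coeff j (oneSubPow (-ν)), mul_sum]
    refine sum_congr rfl fun s hs => ?_
    rw [coeff_oneSubPow, binomCoeff_neg_eq_gamma hν, coeff_mk,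
      Nat.cast_sub (Nat.lt_succ_iff.mp (mem_range.mp hs))]
    push_cast
    ring

/-- The factor `X` replaces a division by `X`; it is cancelled in `isSolution_iff`. -/
theorem X_mul_mk_fwdDiff (x : ℕ → ℂ) :
    X * PowerSeries.mk (fwdDiff 1 x) = (1 - X) * PowerSeries.mk x - C (x 0) := by
  ext n
  rw [sub_mul, one_mul]
  cases n with
  | zero => simp
  | succ n => simp [coeff_succ_X_mul, fwdDiff]

theorem X_mul_mk_caputoDiff {β : ℝ} (hβ0 : 0 < β) (hβ1 : β ≤ 1) (x : ℕ → ℂ) :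
    X * PowerSeries.mk (caputoDiff β x) =
      oneSubPow (β - 1) * ((1 - X) * PowerSeries.mk x - C (x 0)) := by
  have hc : ⌈β⌉₊ = 1 := (Nat.ceil_eq_iff one_ne_zero).mpr ⟨by simpa using hβ0, by simpa using hβ1⟩
  have h : PowerSeries.mk (caputoDiff β x) = oneSubPow (β - 1) * PowerSeries.mk (fwdDiff 1 x) := by
    ext n
    rw [coeff_mk, caputoDiff, hc, fracSum_eq_coeff (by simpa using hβ1), Function.iterate_one,
      Nat.cast_one, neg_sub]
  rw [h, mul_left_comm, X_mul_mk_fwdDiff]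

theorem X_sq_mul_mk_caputoDiff {α : ℝ} (hα1 : 1 < α) (hα2 : α ≤ 2) (x : ℕ → ℂ) :
    X ^ 2 * PowerSeries.mk (caputoDiff α x) = oneSubPow (α - 2) *
      ((1 - X) ^ 2 * PowerSeries.mk x - C (x 0) * (1 - 2 * X) - C (x 1) * X) := by
  have hc : ⌈α⌉₊ = 2 := (Nat.ceil_eq_iff two_ne_zero).mpr ⟨by simpa using hα1, by simpa using hα2⟩
  have h : PowerSeries.mk (caputoDiff α x) =
      oneSubPow (α - 2) * PowerSeries.mk (fwdDiff 1 (fwdDiff 1 x)) := by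
    ext n
    rw [coeff_mk, caputoDiff, hc, fracSum_eq_coeff (by simpa using hα2), Nat.cast_ofNat, neg_sub]
    rfl
  have h0 : C (fwdDiff 1 x 0) = C (x 1) - C (x 0) := by simp [fwdDiff]
  rw [h, mul_left_comm, sq, mul_assoc, X_mul_mk_fwdDiff, h0]
  linear_combination oneSubPow (α - 2) * (1 - X) * X_mul_mk_fwdDiff x

/-- The power series of `w² (F(1/w) - b)`. -/
noncomputable def charSeries (α β a : ℝ) (b : ℂ) : ℂ⟦X⟧ :=
  oneSubPow α + C (a : ℂ) * X * oneSubPow β + C (1 - b) * X ^ 2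

/-- The contribution of the initial values to the transformed equation. -/
noncomputable def dataSeries (α β a : ℝ) (c₀ c₁ : ℂ) : ℂ⟦X⟧ :=
  oneSubPow (α - 2) * (C c₀ * (1 - 2 * X) + C c₁ * X) + C (a : ℂ) * X * (oneSubPow (β - 1) * C c₀)

variable {α β a : ℝ} {b : ℂ} {x : ℕ → ℂ}

/-- The equation is multiplied by `X ^ 2`, a nonzerodivisor, so the passage is reversible; powers of
`1 - X` then recombine into exponents `α` and `β`. -/
theorem isSolution_iff (hβ0 : 0 < β) (hβ1 : β ≤ 1) (hα1 : 1 < α) (hα2 : α ≤ 2) :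
    IsSolution α β a b x ↔
      charSeries α β a b * PowerSeries.mk x = dataSeries α β a (x 0) (x 1) := by
  have h1 : IsSolution α β a b x ↔ PowerSeries.mk (caputoDiff α x) +
      C (a : ℂ) * PowerSeries.mk (caputoDiff β x) = C (b - 1) * PowerSeries.mk x := by
    simp only [PowerSeries.ext_iff, IsSolution, map_add, coeff_C_mul, coeff_mk]
  have hX : (X : ℂ⟦X⟧) ^ 2 ≠ 0 := pow_ne_zero 2 X_ne_zero
  rw [h1, ← mul_right_inj' hX]
  have hα : oneSubPow α = oneSubPow (α - 2) * (1 - X) ^ 2 := by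
    rw [← oneSubPow_one, sq, ← oneSubPow_add, ← oneSubPow_add]
    ring_nf
  have hβ : oneSubPow β = oneSubPow (β - 1) * (1 - X) := by
    rw [← oneSubPow_one, ← oneSubPow_add, sub_add_cancel]
  have e1 := X_sq_mul_mk_caputoDiff hα1 hα2 x
  have e2 := X_mul_mk_caputoDiff hβ0 hβ1 x
  have e3 : (C (b - 1) : ℂ⟦X⟧) = - C (1 - b) := by rw [← map_neg, neg_sub]
  rw [charSeries, dataSeries, hα, hβ, e3]
  constructor <;> intro h
  · linear_combination h - e1 - C (a : ℂ) * X * e2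
  · linear_combination h + e1 + C (a : ℂ) * X * e2

theorem exists_isSolution (hβ0 : 0 < β) (hβ1 : β ≤ 1) (hα1 : 1 < α) (hα2 : α ≤ 2) (a : ℝ)
    (b c₀ c₁ : ℂ) : ∃ x : ℕ → ℂ, IsSolution α β a b x ∧ x 0 = c₀ ∧ x 1 = c₁ := by
  have hP : constantCoeff (charSeries α β a b) = 1 := by
    rw [← coeff_zero_eq_constantCoeff_apply]
    simp [charSeries, mul_assoc]
  have hP0 : constantCoeff (charSeries α β a b) ≠ 0 := by simp [hP]
  set f := (charSeries α β a b)⁻¹ * dataSeries α β a c₀ c₁ with hf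
  have hmul : charSeries α β a b * f = dataSeries α β a c₀ c₁ := by
    rw [hf, ← mul_assoc, PowerSeries.mul_inv_cancel _ hP0, one_mul]
  have hmk : PowerSeries.mk (fun n => coeff n f) = f := by ext n; simp
  have h0 : coeff 0 f = c₀ := by
    have := congrArg (coeff 0) hmul
    simpa [charSeries, dataSeries, mul_assoc, coeff_zero_mul_X] using this
  have h0' : constantCoeff f = c₀ := by simpa using h0
  -- In degree one the terms `(a - α) c₀` on the two sides cancel, which leaves `c₁`.
  have h1 : coeff 1 f = c₁ := by
    have := congrArg (coeff 1) hmul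
    have h2 : constantCoeff (2 : ℂ⟦X⟧) = 2 := map_ofNat _ 2
    simp [charSeries, dataSeries, coeff_one_mul, h0', sq, binomCoeff_one, coeff_C, h2] at this
    linear_combination this
  refine ⟨fun n => coeff n f, ?_, h0, h1⟩
  rw [isSolution_iff hβ0 hβ1 hα1 hα2, hmk, h0, h1, hmul]

end TwoTermFracDiff

end Transform

/-! ### Stability and zeros in the closed unit disk -/

section Stability

open PowerSeries Finset Filter Topology

/-- The power series `f` converges absolutely at `w`, with sum `v`. -/
def HasEval (f : ℂ⟦X⟧) (w v : ℂ) : Prop :=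
  (Summable fun n => ‖coeff n f * w ^ n‖) ∧ seriesEval f w = v

namespace HasEval

variable {f g : ℂ⟦X⟧} {w u v : ℂ}

theorem mul (hf : HasEval f w u) (hg : HasEval g w v) : HasEval (f * g) w (u * v) := by
  refine ⟨?_, by rw [seriesEval_mul hf.1 hg.1, hf.2, hg.2]⟩
  refine (summable_norm_sum_mul_antidiagonal_of_summable_norm hf.1 hg.1).congr fun n => ?_
  rw [coeff_mul, sum_mul]
  refine congrArg norm (sum_congr rfl fun p hp => ?_)
  rw [← mem_antidiagonal.mp hp, pow_add]
  ring

theorem add (hf : HasEval f w u) (hg : HasEval g w v) : HasEval (f + g) w (u + v) := by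
  constructor
  · refine Summable.of_nonneg_of_le (fun _ => norm_nonneg _) (fun n => ?_) (hf.1.add hg.1)
    rw [map_add, add_mul]
    exact norm_add_le _ _
  · rw [← hf.2, ← hg.2, seriesEval, seriesEval, seriesEval,
      ← hf.1.of_norm.tsum_add hg.1.of_norm]
    simp [add_mul]

theorem const (c w : ℂ) : HasEval (C c) w c := by
  have h : ∀ n ≠ 0, coeff n (C c) * w ^ n = 0 := fun n hn => by simp [coeff_C, hn]
  refine ⟨summable_of_ne_finset_zero (s := {0}) fun n hn => ?_, ?_⟩
  · rw [h n (by simpa using hn), norm_zero]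
  · rw [seriesEval, tsum_eq_single 0 h]
    simp

theorem var (w : ℂ) : HasEval X w w := by
  have h : ∀ n ≠ 1, coeff n (X : ℂ⟦X⟧) * w ^ n = 0 := fun n hn => by simp [coeff_X, hn]
  refine ⟨summable_of_ne_finset_zero (s := {1}) fun n hn => ?_, ?_⟩
  · rw [h n (by simpa using hn), norm_zero]
  · rw [seriesEval, tsum_eq_single 1 h]
    simp

theorem oneSubPow_of_lt (γ : ℝ) (hw : ‖w‖ < 1) : HasEval (oneSubPow γ) w ((1 - w) ^ (γ : ℂ)) :=
  ⟨(hasSum_oneSubPow γ hw).summable.norm, (hasSum_oneSubPow γ hw).tsum_eq⟩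

theorem oneSubPow_of_le {γ : ℝ} (hγ0 : 0 < γ) (hγ2 : γ ≤ 2) (hw : ‖w‖ ≤ 1) :
    HasEval (oneSubPow γ) w ((1 - w) ^ (γ : ℂ)) :=
  ⟨summable_norm_coeff_mul_pow (oneSubPow_mem_wienerSubalgebra hγ0.le hγ2) hw,
    seriesEval_oneSubPow hγ0 hγ2 hw⟩

theorem eq (hu : HasEval f w u) (hv : HasEval f w v) : u = v := hu.2.symm.trans hv.2

theorem of_bounded {x : ℕ → ℂ} {M : ℝ} (hx : ∀ n, ‖x n‖ ≤ M) (hw : ‖w‖ < 1) :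
    HasEval (PowerSeries.mk x) w (seriesEval (PowerSeries.mk x) w) := by
  refine ⟨Summable.of_nonneg_of_le (fun _ => norm_nonneg _) (fun n => ?_)
    ((summable_geometric_of_lt_one (norm_nonneg w) hw).mul_left M), rfl⟩
  rw [coeff_mk, norm_mul, norm_pow]
  exact mul_le_mul_of_nonneg_right (hx n) (by positivity)

end HasEval

/-- Constant term one turns `P * f = R` into a recursion for the coefficients of `f`; a geometric
sum closes the induction. This growth bound makes the Z-transform converge near infinity. -/
theorem norm_coeff_le_of_mul_eq {P f R : ℂ⟦X⟧} {M : ℝ} (hP0 : constantCoeff P = 1)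
    (hP : ∀ n, ‖coeff n P‖ ≤ M) (hR : ∀ n, ‖coeff n R‖ ≤ M) (h : P * f = R) (n : ℕ) :
    ‖coeff n f‖ ≤ M * (1 + M) ^ n := by
  have hM : 0 ≤ M := (norm_nonneg _).trans (hP 0)
  induction n using Nat.strong_induction_on with
  | _ n ih =>
    have h1 := congrArg (coeff n) h
    rw [mul_comm, coeff_mul, Nat.sum_antidiagonal_eq_sum_range_succ
      fun i j => coeff i f * coeff j P, sum_range_succ, Nat.sub_self,
      coeff_zero_eq_constantCoeff_apply, hP0, mul_one, ← eq_sub_iff_add_eq'] at h1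
    rw [h1]
    have h2 : ‖∑ k ∈ range n, coeff k f * coeff (n - k) P‖ ≤ M * ((1 + M) ^ n - 1) := by
      have h3 := mul_geom_sum (1 + M) n
      rw [add_sub_cancel_left, mul_sum] at h3
      rw [← h3, mul_sum]
      refine norm_sum_le_of_le _ fun k hk => ?_
      rw [norm_mul, mul_comm M]
      exact mul_le_mul ((ih k (mem_range.mp hk))) (hP _) (norm_nonneg _) (by positivity)
    calc _ ≤ M + M * ((1 + M) ^ n - 1) := (norm_sub_le _ _).trans (add_le_add (hR n) h2)
      _ = _ := by ring

/-- For a null sequence `y`, the radial growth of `∑ y(n) r^n` at `1` is `o(1 / (1 - r))`. -/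
theorem tendsto_one_sub_mul_seriesEval {y : ℕ → ℂ} (hy : Tendsto y atTop (𝓝 0)) :
    Tendsto (fun r : ℝ => (1 - (r : ℂ)) * seriesEval (PowerSeries.mk y) r) (𝓝[<] 1) (𝓝 0) := by
  obtain ⟨M, hM⟩ := (Metric.isBounded_range_of_tendsto _ hy).exists_norm_le
  -- The partial sums of `d` are the terms of `y`, so Abel's limit theorem applies to `∑ d(n) r^n`.
  set d : ℕ → ℂ := fun n => coeff n ((1 - X) * PowerSeries.mk y) with hd
  have hs : ∀ n, ∑ i ∈ range (n + 1), d i = y n := by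
    intro n
    induction n with
    | zero => simp [hd]
    | succ n ih =>
      rw [sum_range_succ, ih]
      simp only [hd, sub_mul, one_mul, map_sub, coeff_succ_X_mul, coeff_mk]
      ring
  have h1 : Tendsto (fun n => ∑ i ∈ range n, d i) atTop (𝓝 0) := by
    rw [← tendsto_add_atTop_iff_nat 1]
    simpa only [hs] using hy
  have h2 := Complex.tendsto_tsum_powerSeries_nhdsWithin_lt h1
  rw [tendsto_map'_iff] at h2
  refine h2.congr' ?_
  filter_upwards [self_mem_nhdsWithin, mem_nhdsWithin_of_mem_nhds (Ioi_mem_nhds zero_lt_one)]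
    with r hr1 hr0
  have hr : ‖(r : ℂ)‖ < 1 := by
    rw [Complex.norm_real, Real.norm_eq_abs, abs_of_pos hr0]
    exact hr1
  have e1 := HasEval.oneSubPow_of_lt (w := (r : ℂ)) 1 hr
  rw [oneSubPow_one, Complex.ofReal_one, Complex.cpow_one] at e1
  exact (e1.mul (HasEval.of_bounded (fun n => hM _ ⟨n, rfl⟩) hr)).2

namespace TwoTermFracDiff

variable {α β a : ℝ} {b : ℂ} {x : ℕ → ℂ}

/-- The function `w² (F(1/w) - b)`. -/
noncomputable def charVal (α β a : ℝ) (b w : ℂ) : ℂ :=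
  (1 - w) ^ (α : ℂ) + a * w * (1 - w) ^ (β : ℂ) + (1 - b) * w ^ 2

theorem charVal_inv {z : ℂ} (hz : z ≠ 0) :
    charVal α β a b z⁻¹ = (z⁻¹) ^ 2 * (charFun α β a z - b) := by
  rw [charVal, charFun]
  field_simp
  ring

/-- The value of `dataSeries` in the open unit disk. -/
noncomputable def dataVal (α β a : ℝ) (c₀ c₁ w : ℂ) : ℂ :=
  (1 - w) ^ ((α - 2 : ℝ) : ℂ) * (c₀ * (1 + -2 * w) + c₁ * w) +
    a * w * ((1 - w) ^ ((β - 1 : ℝ) : ℂ) * c₀)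

theorem hasEval_charSeries (hβ0 : 0 < β) (hβ1 : β ≤ 1) (hα1 : 1 < α) (hα2 : α ≤ 2) (a : ℝ)
    (b : ℂ) {w : ℂ} (hw : ‖w‖ ≤ 1) :
    HasEval (charSeries α β a b) w (charVal α β a b w) := by
  rw [charSeries, charVal, sq, sq]
  exact (((HasEval.oneSubPow_of_le (by linarith) hα2 hw).add
    (((HasEval.const _ _).mul (HasEval.var _)).mul
      (HasEval.oneSubPow_of_le hβ0 (by linarith) hw))).add
    ((HasEval.const _ _).mul ((HasEval.var _).mul (HasEval.var _))))

theorem hasEval_dataSeries (α β a : ℝ) (c₀ c₁ : ℂ) {w : ℂ} (hw : ‖w‖ < 1) :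
    HasEval (dataSeries α β a c₀ c₁) w (dataVal α β a c₀ c₁ w) := by
  have h1 : (1 - 2 * X : ℂ⟦X⟧) = C 1 + C (-2) * X := by
    rw [map_one, map_neg, map_ofNat]
    ring
  rw [dataSeries, dataVal, h1]
  exact ((HasEval.oneSubPow_of_lt _ hw).mul (((HasEval.const _ _).mul ((HasEval.const _ _).add
    ((HasEval.const _ _).mul (HasEval.var _)))).add ((HasEval.const _ _).mul (HasEval.var _)))).add
    (((HasEval.const _ _).mul (HasEval.var _)).mul
      ((HasEval.oneSubPow_of_lt _ hw).mul (HasEval.const _ _)))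

theorem charSeries_mem_wienerSubalgebra (hβ0 : 0 < β) (hβ1 : β ≤ 1) (hα1 : 1 < α) (hα2 : α ≤ 2)
    (a : ℝ) (b : ℂ) : charSeries α β a b ∈ wienerSubalgebra := by
  simpa [mem_wienerSubalgebra] using
    (hasEval_charSeries hβ0 hβ1 hα1 hα2 a b (w := 1) (by simp)).1

theorem dataSeries_eq (α β a : ℝ) (c₀ c₁ : ℂ) :
    dataSeries α β a c₀ c₁ = C c₀ * dataSeries α β a 1 0 + C c₁ * dataSeries α β a 0 1 := by
  simp only [dataSeries, map_one, map_zero]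
  ring

theorem tendsto_coeff_dataSeries (hβ0 : 0 < β) (hβ1 : β ≤ 1) (hα1 : 1 < α) (hα2 : α ≤ 2)
    (a : ℝ) (c₀ c₁ : ℂ) : Tendsto (fun n => coeff n (dataSeries α β a c₀ c₁)) atTop (𝓝 0) := by
  have hC : ∀ c : ℂ, (C c : ℂ⟦X⟧) ∈ wienerSubalgebra := wienerSubalgebra.algebraMap_mem
  have h2 : (2 : ℂ⟦X⟧) ∈ wienerSubalgebra := ofNat_mem _ 2
  have h1 : C c₀ * (1 - 2 * X) + C c₁ * X ∈ wienerSubalgebra :=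
    add_mem (mul_mem (hC _) (sub_mem (one_mem _) (mul_mem h2 X_mem_wienerSubalgebra)))
      (mul_mem (hC _) X_mem_wienerSubalgebra)
  have h3 : C (a : ℂ) * X * C c₀ ∈ wienerSubalgebra :=
    mul_mem (mul_mem (hC _) X_mem_wienerSubalgebra) (hC _)
  have t1 := tendsto_coeff_mul h1 (tendsto_coeff_oneSubPow (γ := α - 2) (by linarith) (by linarith))
  have t2 := tendsto_coeff_mul h3 (tendsto_coeff_oneSubPow (γ := β - 1) (by linarith) (by linarith))
  have t := t1.add t2
  rw [add_zero] at t
  refine t.congr fun n => ?_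
  rw [← map_add, dataSeries]
  congr 1
  ring

theorem IsSolution.exists_norm_le (hβ0 : 0 < β) (hβ1 : β ≤ 1) (hα1 : 1 < α) (hα2 : α ≤ 2)
    (hx : IsSolution α β a b x) : ∃ M : ℝ, 0 ≤ M ∧ ∀ n, ‖x n‖ ≤ M * (1 + M) ^ n := by
  rw [isSolution_iff hβ0 hβ1 hα1 hα2] at hx
  obtain ⟨M, hM⟩ := (Metric.isBounded_range_of_tendsto _
    (tendsto_coeff_dataSeries hβ0 hβ1 hα1 hα2 a (x 0) (x 1))).exists_norm_le
  have hP := charSeries_mem_wienerSubalgebra hβ0 hβ1 hα1 hα2 a b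
  have hP0 : constantCoeff (charSeries α β a b) = 1 := by simp [charSeries, mul_assoc]
  have h1 : ∀ n, ‖coeff n (charSeries α β a b)‖ ≤
      max (∑' n, ‖coeff n (charSeries α β a b)‖) M := fun n =>
    (hP.le_tsum n fun _ _ => norm_nonneg _).trans (le_max_left _ _)
  refine ⟨_, (norm_nonneg _).trans (h1 0), fun n => ?_⟩
  simpa using norm_coeff_le_of_mul_eq hP0 h1
    (fun n => (hM _ ⟨n, rfl⟩).trans (le_max_right _ _)) hx n

theorem IsSolution.exists_summable (hβ0 : 0 < β) (hβ1 : β ≤ 1) (hα1 : 1 < α) (hα2 : α ≤ 2)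
    (hx : IsSolution α β a b x) :
    ∃ R : ℝ, ∀ z : ℂ, R < ‖z‖ → Summable fun n : ℕ => x n * (z⁻¹) ^ n := by
  obtain ⟨M, hM, h⟩ := hx.exists_norm_le hβ0 hβ1 hα1 hα2
  refine ⟨1 + M, fun z hz => ?_⟩
  have hz0 : 0 < ‖z‖ := by linarith
  refine Summable.of_norm_bounded ((summable_geometric_of_lt_one (r := (1 + M) * ‖z‖⁻¹)
    (by positivity) (by rwa [← div_eq_mul_inv, div_lt_one hz0])).mul_left M) fun n => ?_
  rw [norm_mul, norm_pow, norm_inv, mul_pow, ← mul_assoc]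
  exact mul_le_mul_of_nonneg_right (h n) (by positivity)

/-- For `‖z‖ > 1` the base `1 - z⁻¹` avoids the negative axis, so inversion commutes with the
principal power. -/
theorem one_sub_inv_cpow_neg {z : ℂ} (hz : 1 < ‖z‖) (ν : ℝ) :
    (1 - z⁻¹) ^ ((-ν : ℝ) : ℂ) = (z / (z - 1)) ^ (ν : ℂ) := by
  have hz0 : z ≠ 0 := norm_pos_iff.mp (by linarith)
  have hw : ‖z⁻¹‖ < 1 := by
    rw [norm_inv]
    exact inv_lt_one_of_one_lt₀ hz
  have h1 : z / (z - 1) = (1 - z⁻¹)⁻¹ := by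
    rw [← inv_div, sub_div, div_self hz0, one_div]
  have hs := one_sub_mem_slitPlane hw.le (by
    rintro h
    simp [h] at hw)
  rw [h1, Complex.inv_cpow _ _ (Complex.mem_slitPlane_iff_arg.mp hs).1, Complex.ofReal_neg,
    Complex.cpow_neg]

theorem IsSolution.zTransform_eq (hβ0 : 0 < β) (hβ1 : β ≤ 1) (hα1 : 1 < α) (hα2 : α ≤ 2)
    (hx : IsSolution α β a b x) {z : ℂ} (hz : 1 < ‖z‖)
    (hs : Summable fun n : ℕ => x n * (z⁻¹) ^ n) :
    (charFun α β a z - b) * zTransform x z =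
      (z * (z - 2) * (z / (z - 1)) ^ ((2 - α : ℝ) : ℂ) +
        (a : ℂ) * z * (z / (z - 1)) ^ ((1 - β : ℝ) : ℂ)) * x 0 +
      z * (z / (z - 1)) ^ ((2 - α : ℝ) : ℂ) * x 1 := by
  have hz0 : z ≠ 0 := norm_pos_iff.mp (by linarith)
  have hw : ‖z⁻¹‖ < 1 := by
    rw [norm_inv]
    exact inv_lt_one_of_one_lt₀ hz
  have e1 : HasEval (PowerSeries.mk x) z⁻¹ (zTransform x z) :=
    ⟨by simpa using hs.norm, by simp [seriesEval, zTransform]⟩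
  have e2 := (hasEval_charSeries hβ0 hβ1 hα1 hα2 a b hw.le).mul e1
  rw [(isSolution_iff hβ0 hβ1 hα1 hα2).mp hx, charVal_inv hz0] at e2
  have e3 := e2.eq (hasEval_dataSeries _ _ _ _ _ hw)
  rw [dataVal, ← neg_sub 2 α, ← neg_sub 1 β, one_sub_inv_cpow_neg hz, one_sub_inv_cpow_neg hz] at e3
  have e4 : (charFun α β a z - b) * zTransform x z =
      z ^ 2 * ((z⁻¹) ^ 2 * (charFun α β a z - b) * zTransform x z) := by
    field_simp
  rw [e4, e3]
  field_simp
  ring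

/-- This settles the zero at `w = 1`, where the powers are not differentiable in general and the
radial argument is unavailable. -/
theorem isSolution_const (hβ0 : 0 < β) (hβ1 : β ≤ 1) (hα1 : 1 < α) (hα2 : α ≤ 2) (a : ℝ) :
    IsSolution α β a 1 fun _ => 1 := by
  have hR : dataSeries α β a 1 1 = charSeries α β a 1 * oneSubPow (-1) := by
    have h1 : oneSubPow α = oneSubPow (α - 2) * (1 - X) * oneSubPow 1 := by
      rw [← oneSubPow_one, ← oneSubPow_add, ← oneSubPow_add]
      ring_nf
    have h2 : oneSubPow β = oneSubPow (β - 1) * oneSubPow 1 := by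
      rw [← oneSubPow_add, sub_add_cancel]
    have h3 : oneSubPow 1 * oneSubPow (-1) = 1 := by
      rw [← oneSubPow_add, add_neg_cancel, oneSubPow_zero]
    rw [charSeries, dataSeries, h1, h2, sub_self, map_zero, map_one]
    linear_combination (-oneSubPow (α - 2) * (1 - X) - C (a : ℂ) * X * oneSubPow (β - 1)) * h3
  have h4 : (PowerSeries.mk fun _ => 1 : ℂ⟦X⟧) = oneSubPow (-1) := by
    ext n
    have hn : Real.Gamma ((n : ℝ) + 1) ≠ 0 := (Real.Gamma_pos_of_pos (by positivity)).ne'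
    simp [binomCoeff_neg_eq_gamma one_pos, hn]
  rw [isSolution_iff hβ0 hβ1 hα1 hα2, hR, h4]

theorem asymptoticallyStable_of_charVal_ne_zero (hβ0 : 0 < β) (hβ1 : β ≤ 1) (hα1 : 1 < α)
    (hα2 : α ≤ 2) (h : ∀ w : ℂ, ‖w‖ ≤ 1 → charVal α β a b w ≠ 0) :
    AsymptoticallyStable α β a b := by
  obtain ⟨g, hg, hPg⟩ := exists_mul_eq_one_of_seriesEval_ne_zero
    (charSeries_mem_wienerSubalgebra hβ0 hβ1 hα1 hα2 a b) fun w hw => by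
      rw [(hasEval_charSeries hβ0 hβ1 hα1 hα2 a b hw).2]
      exact h w hw
  have t : ∀ c₀ c₁, Tendsto (fun n => coeff n (g * dataSeries α β a c₀ c₁)) atTop (𝓝 0) :=
    fun c₀ c₁ => tendsto_coeff_mul hg (tendsto_coeff_dataSeries hβ0 hβ1 hα1 hα2 a c₀ c₁)
  have hsol : ∀ x, IsSolution α β a b x → ∀ n, x n = coeff n (g * dataSeries α β a (x 0) (x 1)) := by
    intro x hx n
    rw [← (isSolution_iff hβ0 hβ1 hα1 hα2).mp hx, ← mul_assoc, mul_comm g, hPg, one_mul, coeff_mk]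
  constructor
  · intro ε hε
    -- `K` and `L` bound the two fundamental solutions, of which every solution is the combination
    -- with weights `x 0` and `x 1`.
    obtain ⟨K, hK⟩ := (Metric.isBounded_range_of_tendsto _ (t 1 0)).exists_norm_le
    obtain ⟨L, hL⟩ := (Metric.isBounded_range_of_tendsto _ (t 0 1)).exists_norm_le
    have hK0 : 0 ≤ K := (norm_nonneg _).trans (hK _ ⟨0, rfl⟩)
    have hL0 : 0 ≤ L := (norm_nonneg _).trans (hL _ ⟨0, rfl⟩)
    refine ⟨ε / (K + L + 1), by positivity, fun x hx h0 h1 n => ?_⟩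
    rw [hsol x hx n, dataSeries_eq, mul_add, mul_left_comm, mul_left_comm g, map_add, coeff_C_mul,
      coeff_C_mul]
    refine (norm_add_le _ _).trans_lt ?_
    rw [norm_mul, norm_mul]
    calc _ ≤ ε / (K + L + 1) * K + ε / (K + L + 1) * L :=
          add_le_add (mul_le_mul h0.le (hK _ ⟨n, rfl⟩) (norm_nonneg _) (by positivity))
            (mul_le_mul h1.le (hL _ ⟨n, rfl⟩) (norm_nonneg _) (by positivity))
      _ = ε * ((K + L) / (K + L + 1)) := by ring
      _ < ε := mul_lt_of_lt_one_right hε ((div_lt_one (by positivity)).mpr (by linarith))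
  · intro x hx
    exact (t (x 0) (x 1)).congr fun n => (hsol x hx n).symm

theorem charVal_ne_zero_of_asymptoticallyStable (hβ0 : 0 < β) (hβ1 : β ≤ 1) (hα1 : 1 < α)
    (hα2 : α ≤ 2) (h : AsymptoticallyStable α β a b) {w : ℂ} (hw : ‖w‖ ≤ 1) :
    charVal α β a b w ≠ 0 := by
  intro hP
  have hαc : (α : ℂ) ≠ 0 := by exact_mod_cast (by linarith : α ≠ 0)
  rcases eq_or_ne w 1 with rfl | hw1
  · have hβc : (β : ℂ) ≠ 0 := by exact_mod_cast hβ0.ne'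
    have hb : b = 1 := by
      rw [charVal, sub_self, Complex.zero_cpow hαc, Complex.zero_cpow hβc] at hP
      linear_combination -hP
    subst hb
    have := tendsto_nhds_unique (h.2 _ (isSolution_const hβ0 hβ1 hα1 hα2 a)) tendsto_const_nhds
    exact zero_ne_one this
  have hw0 : w ≠ 0 := by
    rintro rfl
    simp [charVal] at hP
  -- With `x 0 = 0` the data reduce to `w (1 - w)^(α - 2)`, which is nonzero for `w ≠ 0, 1`.
  obtain ⟨x, hx, hx0, hx1⟩ := exists_isSolution hβ0 hβ1 hα1 hα2 a b 0 1
  have hxt := h.2 x hx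
  obtain ⟨M, hM⟩ := (Metric.isBounded_range_of_tendsto _ hxt).exists_norm_le
  have hs := one_sub_mem_slitPlane hw hw1
  have hyt : Tendsto (fun n => x n * w ^ n) atTop (𝓝 0) := by
    refine squeeze_zero_norm (fun n => ?_) (tendsto_zero_iff_norm_tendsto_zero.mp hxt)
    rw [norm_mul, norm_pow]
    exact mul_le_of_le_one_right (norm_nonneg _) (pow_le_one₀ (norm_nonneg _) hw)
  have t1 := tendsto_one_sub_mul_seriesEval hyt
  set G : ℝ → ℂ := fun r => charVal α β a b (r * w) with hG
  -- Even on the unit circle, `1 - w` lies in the slit plane, so the principal powers are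
  -- differentiable at `w`.
  have hd : DifferentiableAt ℝ G 1 := by
    have h1 : DifferentiableAt ℂ (charVal α β a b) (((1 : ℝ) : ℂ) * w) := by
      rw [Complex.ofReal_one, one_mul]
      have h2 : DifferentiableAt ℂ (fun w : ℂ => 1 - w) w := by fun_prop
      exact ((h2.cpow_const hs).add ((differentiableAt_id.const_mul _).mul
        (h2.cpow_const hs))).add ((differentiableAt_id.pow 2).const_mul _)
    exact DifferentiableAt.comp (f := fun r : ℝ => (r : ℂ) * w) (1 : ℝ) (h1.restrictScalars ℝ)
      (Complex.ofRealCLM.differentiableAt.mul_const w)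
  have t2 := (hasDerivAt_iff_tendsto_slope.mp hd.hasDerivAt).mono_left
    (nhdsWithin_mono _ fun r (hr : r < 1) => hr.ne)
  have t3 := (t2.mul t1).neg
  rw [mul_zero, neg_zero] at t3
  -- For `r < 1` the data equal minus the slope of `G` at `1`, which converges, times `(1 - r) ∑
  -- x(n) w^n r^n`, which tends to zero.
  have hGD : Tendsto (fun r : ℝ => dataVal α β a 0 1 (r * w)) (𝓝[<] 1) (𝓝 0) := by
    refine t3.congr' ?_
    filter_upwards [self_mem_nhdsWithin, mem_nhdsWithin_of_mem_nhds (Ioi_mem_nhds zero_lt_one)]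
      with r hr1 hr0
    have hrw : ‖(r : ℂ) * w‖ < 1 := by
      rw [norm_mul, Complex.norm_real, Real.norm_eq_abs, abs_of_pos hr0]
      exact (mul_le_of_le_one_right (le_of_lt hr0) hw).trans_lt hr1
    have e1 := (hasEval_charSeries hβ0 hβ1 hα1 hα2 a b hrw.le).mul
      (HasEval.of_bounded (fun n => hM _ ⟨n, rfl⟩) hrw)
    rw [(isSolution_iff hβ0 hβ1 hα1 hα2).mp hx, hx0, hx1] at e1
    have e2 := e1.eq (hasEval_dataSeries α β a 0 1 hrw)
    have e3 : seriesEval (PowerSeries.mk x) (r * w) =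
        seriesEval (PowerSeries.mk fun n => x n * w ^ n) r := by
      refine tsum_congr fun n => ?_
      simp only [coeff_mk, mul_pow]
      ring
    have hG1 : G 1 = 0 := by simpa [hG] using hP
    have hr1' : (r : ℂ) - 1 ≠ 0 := by exact_mod_cast (sub_neg.mpr hr1).ne
    rw [← e2, e3, slope_def_module, hG1, sub_zero, Complex.real_smul]
    push_cast
    field_simp
    ring
  have hGD' : Tendsto (fun r : ℝ => dataVal α β a 0 1 (r * w)) (𝓝[<] 1)
      (𝓝 ((1 - w) ^ ((α - 2 : ℝ) : ℂ) * w)) := by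
    have hc : ContinuousAt (fun r : ℝ => (1 - (r : ℂ) * w) ^ ((α - 2 : ℝ) : ℂ) * (r * w)) 1 := by
      refine ContinuousAt.mul (ContinuousAt.cpow (by fun_prop) continuousAt_const ?_) (by fun_prop)
      simpa using hs
    have hc' := hc.tendsto.mono_left (nhdsWithin_le_nhds (s := Set.Iio 1))
    simpa [dataVal] using hc'
  have := tendsto_nhds_unique hGD hGD'
  exact mul_ne_zero (by simp [Complex.cpow_eq_zero_iff, Complex.slitPlane_ne_zero hs]) hw0 this.symm

theorem asymptoticallyStable_iff_charVal_ne_zero (hβ0 : 0 < β) (hβ1 : β ≤ 1) (hα1 : 1 < α)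
    (hα2 : α ≤ 2) :
    AsymptoticallyStable α β a b ↔ ∀ w : ℂ, ‖w‖ ≤ 1 → charVal α β a b w ≠ 0 :=
  ⟨fun h _ hw => charVal_ne_zero_of_asymptoticallyStable hβ0 hβ1 hα1 hα2 h hw,
    asymptoticallyStable_of_charVal_ne_zero hβ0 hβ1 hα1 hα2⟩

theorem asymptoticallyStable_iff_roots (hβ0 : 0 < β) (hβ1 : β ≤ 1) (hα1 : 1 < α)
    (hα2 : α ≤ 2) :
    AsymptoticallyStable α β a b ↔ ∀ z : ℂ, z ≠ 0 → charFun α β a z = b → ‖z‖ < 1 := by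
  rw [asymptoticallyStable_iff_charVal_ne_zero hβ0 hβ1 hα1 hα2]
  constructor
  · intro h z hz hzb
    by_contra hn
    refine h z⁻¹ ?_ (by rw [charVal_inv hz, hzb, sub_self, mul_zero])
    rw [norm_inv]
    exact inv_le_one_of_one_le₀ (not_lt.mp hn)
  · intro h w hw hP
    have hw0 : w ≠ 0 := by
      rintro rfl
      simp [charVal] at hP
    rw [← inv_inv w, charVal_inv (inv_ne_zero hw0), inv_inv] at hP
    have h1 := h w⁻¹ (inv_ne_zero hw0)
      (sub_eq_zero.mp ((mul_eq_zero.mp hP).resolve_left (pow_ne_zero 2 hw0)))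
    rw [norm_inv] at h1
    exact absurd ((one_le_inv₀ (norm_pos_iff.mpr hw0)).mpr hw) (not_le.mpr h1)

end TwoTermFracDiff

end Stability

/-! ### Winding numbers and the argument principle -/

section Winding

open Filter Topology

namespace TwoTermFracDiff

namespace HasWindingNumber

variable {c c' : ℝ → ℂ} {b : ℂ} {k l : ℤ}

theorem sub_iff : HasWindingNumber c b k ↔ HasWindingNumber (fun θ => c θ - b) 0 k := by
  simp only [HasWindingNumber, sub_zero, ne_eq, sub_eq_zero]

theorem congr (h : ∀ θ ∈ Set.Icc 0 (2 * Real.pi), c θ = c' θ) (hc : HasWindingNumber c b k) :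
    HasWindingNumber c' b k := by
  obtain ⟨h0, φ, hφ, h1, h2⟩ := hc
  refine ⟨fun θ hθ => ?_, φ, hφ, fun θ hθ => ?_, h2⟩
  · rw [← h θ hθ]
    exact h0 θ hθ
  · rw [← h θ hθ]
    exact h1 θ hθ

theorem mul (hc : HasWindingNumber c 0 k) (hc' : HasWindingNumber c' 0 l) :
    HasWindingNumber (fun θ => c θ * c' θ) 0 (k + l) := by
  obtain ⟨h0, φ, hφ, h1, h2⟩ := hc
  obtain ⟨h0', φ', hφ', h1', h2'⟩ := hc'
  refine ⟨fun θ hθ => mul_ne_zero (h0 θ hθ) (h0' θ hθ), fun θ => φ θ + φ' θ, hφ.add hφ',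
    fun θ hθ => ?_, ?_⟩
  · have e := h1 θ hθ
    have e' := h1' θ hθ
    rw [sub_zero] at e e'
    simp only [sub_zero, norm_mul, Complex.ofReal_mul, Complex.ofReal_add, add_mul, Complex.exp_add]
    rw [mul_mul_mul_comm, ← e, ← e']
  · push_cast
    linear_combination h2 + h2'

theorem of_slitPlane (hc : ContinuousOn c (Set.Icc 0 (2 * Real.pi)))
    (h0 : c 0 = c (2 * Real.pi)) (h : ∀ θ ∈ Set.Icc 0 (2 * Real.pi), c θ ∈ Complex.slitPlane) :
    HasWindingNumber c 0 0 := by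
  refine ⟨fun θ hθ => Complex.slitPlane_ne_zero (h θ hθ), fun θ => (c θ).arg, fun θ hθ => ?_,
    fun θ _ => ?_, ?_⟩
  · exact (Complex.continuousAt_arg (h θ hθ)).comp_continuousWithinAt (hc θ hθ)
  · rw [sub_zero, Complex.norm_mul_exp_arg_mul_I]
  · simp [h0]

theorem const {u : ℂ} (hu : u ≠ 0) : HasWindingNumber (fun _ => u) 0 0 :=
  ⟨fun _ _ => hu, fun _ => u.arg, continuousOn_const,
    fun _ _ => by rw [sub_zero, Complex.norm_mul_exp_arg_mul_I], by simp⟩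

theorem exp_int_mul (k : ℤ) :
    HasWindingNumber (fun θ => Complex.exp (k * (θ * Complex.I))) 0 k := by
  refine ⟨fun _ _ => Complex.exp_ne_zero _, fun θ => k * θ, by fun_prop, fun θ _ => ?_, ?_⟩
  · have h : (k : ℂ) * (θ * Complex.I) = ((k * θ : ℝ) : ℂ) * Complex.I := by
      push_cast
      ring
    simp only [sub_zero, h]
    rw [Complex.norm_exp_ofReal_mul_I, Complex.ofReal_one, one_mul]
  · ring

/-- Two continuous arguments differ by `2π` times a continuous integer-valued function, which is
constant on an interval. -/
theorem unique (hc : HasWindingNumber c b k) (hc' : HasWindingNumber c b l) : k = l := by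
  obtain ⟨h0, φ, hφ, h1, h2⟩ := hc
  obtain ⟨_, ψ, hψ, h1', h2'⟩ := hc'
  have hπ : (0 : ℝ) < 2 * Real.pi := Real.two_pi_pos
  set g : ℝ → ℝ := fun θ => (φ θ - ψ θ) / (2 * Real.pi) with hg
  have hgc : ContinuousOn g (Set.Icc 0 (2 * Real.pi)) := (hφ.sub hψ).div_const _
  have hgi : Set.MapsTo g (Set.Icc 0 (2 * Real.pi)) (Set.range ((↑) : ℤ → ℝ)) := by
    intro θ hθ
    have hn : (‖c θ - b‖ : ℂ) ≠ 0 := by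
      exact_mod_cast norm_ne_zero_iff.mpr (sub_ne_zero.mpr (h0 θ hθ))
    have he := mul_left_cancel₀ hn ((h1 θ hθ).symm.trans (h1' θ hθ))
    obtain ⟨n, hn⟩ := Complex.exp_eq_exp_iff_exists_int.mp he
    refine ⟨n, ?_⟩
    have h3 : ((φ θ : ℂ)) = ψ θ + n * (2 * Real.pi) := by
      refine mul_right_cancel₀ Complex.I_ne_zero ?_
      linear_combination hn
    have h4 : φ θ = ψ θ + n * (2 * Real.pi) := by exact_mod_cast h3
    rw [hg]
    simp only [h4]
    field_simp
    ring
  have hconst := isPreconnected_Icc.constant_of_mapsTo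
    Int.isClosedEmbedding_coe_real.isInducing.isDiscrete_range hgc hgi
    (Set.left_mem_Icc.mpr hπ.le) (Set.right_mem_Icc.mpr hπ.le)
  have h5 : (k : ℝ) - l = g (2 * Real.pi) - g 0 := by
    rw [hg]
    field_simp
    linear_combination h2' - h2
  rw [hconst, sub_self, sub_eq_zero] at h5
  exact_mod_cast h5

/-- Rouché: the quotient `c' / c` stays in the open unit disk around `1`, so it does not wind around
zero. -/
theorem of_norm_sub_lt (hc : HasWindingNumber c 0 k)
    (hcont : ContinuousOn c (Set.Icc 0 (2 * Real.pi)))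
    (hcont' : ContinuousOn c' (Set.Icc 0 (2 * Real.pi))) (h0 : c 0 = c (2 * Real.pi))
    (h0' : c' 0 = c' (2 * Real.pi))
    (h : ∀ θ ∈ Set.Icc 0 (2 * Real.pi), ‖c' θ - c θ‖ < ‖c θ‖) : HasWindingNumber c' 0 k := by
  have hq : HasWindingNumber (fun θ => c' θ / c θ) 0 0 := by
    refine of_slitPlane (hcont'.div hcont hc.1) (by simp only [h0, h0']) fun θ hθ => ?_
    have hcθ := hc.1 θ hθ
    have e : c' θ / c θ = 1 + (c' θ - c θ) / c θ := by
      field_simp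
      ring
    rw [e]
    refine Complex.mem_slitPlane_of_norm_lt_one ?_
    rw [norm_div]
    exact (div_lt_one (norm_pos_iff.mpr hcθ)).mpr (h θ hθ)
  have hm := hc.mul hq
  rw [add_zero] at hm
  exact hm.congr fun θ hθ => mul_div_cancel₀ _ (hc.1 θ hθ)

end HasWindingNumber

/-- The unit circle, run through clockwise. -/
noncomputable def clockwise (θ : ℝ) : ℂ := Complex.exp (-(θ * Complex.I))

theorem continuous_clockwise : Continuous clockwise := by
  unfold clockwise
  fun_prop

theorem norm_clockwise (θ : ℝ) : ‖clockwise θ‖ = 1 := by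
  rw [clockwise, ← neg_mul, ← Complex.ofReal_neg, Complex.norm_exp_ofReal_mul_I]

theorem clockwise_ne_zero (θ : ℝ) : clockwise θ ≠ 0 := Complex.exp_ne_zero _

theorem clockwise_zero : clockwise 0 = 1 := by simp [clockwise]

theorem clockwise_two_pi : clockwise (2 * Real.pi) = 1 := by
  rw [clockwise, Complex.exp_neg]
  push_cast
  rw [Complex.exp_two_pi_mul_I, inv_one]

theorem exists_clockwise_eq {w : ℂ} (hw : ‖w‖ = 1) :
    ∃ θ ∈ Set.Icc 0 (2 * Real.pi), clockwise θ = w := by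
  have hw0 : w ≠ 0 := norm_pos_iff.mp (by rw [hw]; exact one_pos)
  have h1 : w⁻¹ = Complex.exp (w⁻¹.arg * Complex.I) := by
    have := Complex.norm_mul_exp_arg_mul_I w⁻¹
    rw [norm_inv, hw, inv_one, Complex.ofReal_one, one_mul] at this
    exact this.symm
  have hπ := Real.pi_pos
  rcases le_or_gt 0 w⁻¹.arg with h | h
  · refine ⟨w⁻¹.arg, ⟨h, by linarith [Complex.arg_le_pi w⁻¹]⟩, ?_⟩
    rw [clockwise, Complex.exp_neg, ← h1, inv_inv]
  · refine ⟨w⁻¹.arg + 2 * Real.pi, ⟨by linarith [Complex.neg_pi_lt_arg w⁻¹], by linarith⟩, ?_⟩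
    rw [clockwise, Complex.exp_neg]
    push_cast
    rw [add_mul, Complex.exp_add, ← h1, Complex.exp_two_pi_mul_I, mul_one, inv_inv]

theorem hasWindingNumber_clockwise : HasWindingNumber clockwise 0 (-1) :=
  (HasWindingNumber.exp_int_mul (-1)).congr fun θ _ => by simp [clockwise]

theorem hasWindingNumber_one_sub {c : ℝ → ℂ} (hc : Continuous c) (h0 : c 0 = c (2 * Real.pi))
    (h : ∀ θ, ‖c θ‖ < 1) : HasWindingNumber (fun θ => 1 - c θ) 0 0 := by
  refine HasWindingNumber.of_slitPlane (by fun_prop) (by rw [h0]) fun θ _ => ?_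
  rw [sub_eq_add_neg]
  exact Complex.mem_slitPlane_of_norm_lt_one (by rw [norm_neg]; exact h θ)

theorem hasWindingNumber_clockwise_sub_of_lt {u : ℂ} (hu : ‖u‖ < 1) :
    HasWindingNumber (fun θ => clockwise θ - u) 0 (-1) := by
  have h := hasWindingNumber_clockwise.mul (hasWindingNumber_one_sub
    (c := fun θ => u / clockwise θ)
    (continuous_const.div continuous_clockwise clockwise_ne_zero)
    (by rw [clockwise_zero, clockwise_two_pi])
    fun θ => by rwa [norm_div, norm_clockwise, div_one])
  refine h.congr fun θ _ => ?_
  have := clockwise_ne_zero θ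
  field_simp

theorem hasWindingNumber_clockwise_sub_of_gt {u : ℂ} (hu : 1 < ‖u‖) :
    HasWindingNumber (fun θ => clockwise θ - u) 0 0 := by
  have hu0 : u ≠ 0 := norm_pos_iff.mp (by linarith)
  have h := (HasWindingNumber.const (neg_ne_zero.mpr hu0)).mul (hasWindingNumber_one_sub
    (c := fun θ => clockwise θ / u) (continuous_clockwise.div_const u)
    (by rw [clockwise_zero, clockwise_two_pi])
    fun θ => by
      rw [norm_div, norm_clockwise]
      exact (div_lt_one (by linarith)).mpr hu)
  refine h.congr fun θ _ => ?_
  field_simp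
  ring

/-- Clockwise, each inner root contributes `-1` and each outer root `0`; contributions of one sign
cannot cancel. -/
theorem exists_hasWindingNumber_prod (s : Multiset ℂ) (hs : ∀ u ∈ s, ‖u‖ ≠ 1) :
    ∃ k : ℕ, HasWindingNumber (fun θ => (s.map fun u => clockwise θ - u).prod) 0 (-k) ∧
      (k = 0 ↔ ∀ u ∈ s, 1 < ‖u‖) := by
  induction s using Multiset.induction_on with
  | empty => exact ⟨0, by simpa using HasWindingNumber.const one_ne_zero, by simp⟩
  | cons u s ih =>
    obtain ⟨k, hk, hk0⟩ := ih fun v hv => hs v (Multiset.mem_cons_of_mem hv)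
    simp only [Multiset.map_cons, Multiset.prod_cons, Multiset.forall_mem_cons]
    rcases lt_or_gt_of_ne (hs u (Multiset.mem_cons_self u s)) with hu | hu
    · refine ⟨k + 1, ?_, by simp [hu.le]⟩
      have h := (hasWindingNumber_clockwise_sub_of_lt hu).mul hk
      rwa [show -((k + 1 : ℕ) : ℤ) = -1 + -k by push_cast; ring]
    · refine ⟨k, ?_, by simp [hu, hk0]⟩
      have h := (hasWindingNumber_clockwise_sub_of_gt hu).mul hk
      rwa [zero_add] at h

/-- The argument principle for polynomials on the unit disk. -/
theorem exists_hasWindingNumber_eval (Q : Polynomial ℂ) (hQ : ∀ w : ℂ, ‖w‖ = 1 → Q.eval w ≠ 0) :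
    ∃ k : ℕ, HasWindingNumber (fun θ => Q.eval (clockwise θ)) 0 (-k) ∧
      (k = 0 ↔ ∀ w : ℂ, ‖w‖ ≤ 1 → Q.eval w ≠ 0) := by
  have hQ0 : Q ≠ 0 := by
    rintro rfl
    exact hQ 1 (by simp) (by simp)
  obtain ⟨k, hk, hk0⟩ := exists_hasWindingNumber_prod Q.roots fun u hu hu1 =>
    hQ u hu1 ((Polynomial.mem_roots hQ0).mp hu)
  refine ⟨k, ?_, hk0.trans ⟨fun h w hw hw0 => ?_, fun h u hu => ?_⟩⟩
  · have h := (HasWindingNumber.const (Polynomial.leadingCoeff_ne_zero.mpr hQ0)).mul hk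
    rw [zero_add] at h
    refine h.congr fun θ _ => ?_
    conv_rhs => rw [(IsAlgClosed.splits Q).eq_prod_roots]
    simp [Polynomial.eval_multiset_prod, Multiset.map_map]
  · exact absurd (h w ((Polynomial.mem_roots hQ0).mpr hw0)) (not_lt.mpr hw)
  · by_contra hn
    exact h u (not_lt.mp hn) ((Polynomial.mem_roots hQ0).mp hu)

theorem exists_pos_le_norm {f : ℂ → ℂ} {s : Set ℂ} (hs : IsCompact s) (hne : s.Nonempty)
    (hf : ContinuousOn f s) (h0 : ∀ w ∈ s, f w ≠ 0) : ∃ m > 0, ∀ w ∈ s, m ≤ ‖f w‖ := by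
  obtain ⟨w₀, hw₀, hmin⟩ := hs.exists_isMinOn hne hf.norm
  exact ⟨‖f w₀‖, norm_pos_iff.mpr (h0 w₀ hw₀), fun w hw => hmin hw⟩

/-- A uniform limit of polynomials on the closed unit disk has winding number `0` along the unit
circle if and only if it has no zeros. -/
theorem hasWindingNumber_zero_iff_ne_zero {f : ℂ → ℂ}
    (hf : ContinuousOn f (Metric.closedBall 0 1))
    (happ : ∀ ε > 0, ∃ Q : Polynomial ℂ, ∀ w : ℂ, ‖w‖ ≤ 1 → ‖f w - Q.eval w‖ < ε) :
    HasWindingNumber (fun θ => f (clockwise θ)) 0 0 ↔ ∀ w : ℂ, ‖w‖ ≤ 1 → f w ≠ 0 := by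
  have hcf : ContinuousOn (fun θ => f (clockwise θ)) (Set.Icc 0 (2 * Real.pi)) :=
    hf.comp continuous_clockwise.continuousOn fun θ _ => by simp [norm_clockwise]
  have hcQ : ∀ Q : Polynomial ℂ,
      ContinuousOn (fun θ => Q.eval (clockwise θ)) (Set.Icc 0 (2 * Real.pi)) :=
    fun Q => (Q.continuous.comp continuous_clockwise).continuousOn
  constructor
  · intro h w₀ hw₀ hfw₀
    obtain ⟨m, hm, hmf⟩ := exists_pos_le_norm (isCompact_sphere (0 : ℂ) 1) ⟨1, by simp⟩
      (hf.mono Metric.sphere_subset_closedBall) fun w hw => by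
        obtain ⟨θ, hθ, rfl⟩ := exists_clockwise_eq (w := w) (by simpa using hw)
        exact h.1 θ hθ
    obtain ⟨Q, hQ⟩ := happ (m / 2) (half_pos hm)
    -- Subtracting `Q.eval w₀` gives the approximant an exact zero at `w₀`. As `f w₀ = 0`, this
    -- costs less than another `m / 2`, so the total error stays below `m ≤ ‖f w‖` on the circle.
    have hQ' : ∀ w : ℂ, ‖w‖ = 1 →
        ‖(Q - Polynomial.C (Q.eval w₀)).eval w - f w‖ < ‖f w‖ := fun w hw => by
      have h1 := hQ w hw.le
      have h2 := hQ w₀ hw₀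
      rw [hfw₀, zero_sub, norm_neg] at h2
      rw [norm_sub_rev, Polynomial.eval_sub, Polynomial.eval_C,
        show f w - (Q.eval w - Q.eval w₀) = (f w - Q.eval w) + Q.eval w₀ by ring]
      linarith [norm_add_le (f w - Q.eval w) (Q.eval w₀), hmf w (by simpa using hw)]
    obtain ⟨k, hk, hk0⟩ := exists_hasWindingNumber_eval (Q - Polynomial.C (Q.eval w₀))
      fun w hw h0 => by simpa [h0] using hQ' w hw
    have h3 := h.of_norm_sub_lt hcf (hcQ _) (by simp only [clockwise_zero, clockwise_two_pi])
      (by simp only [clockwise_zero, clockwise_two_pi]) fun θ _ => hQ' _ (norm_clockwise θ)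
    have hk1 : k = 0 := by simpa using (h3.unique hk).symm
    exact hk0.mp hk1 w₀ hw₀ (by simp)
  · intro h
    obtain ⟨m, hm, hmf⟩ := exists_pos_le_norm (isCompact_closedBall (0 : ℂ) 1) ⟨0, by simp⟩
      hf fun w hw => h w (by simpa using hw)
    obtain ⟨Q, hQ⟩ := happ (m / 2) (half_pos hm)
    have hQ' : ∀ w : ℂ, ‖w‖ ≤ 1 → m / 2 < ‖Q.eval w‖ := fun w hw => by
      have h1 := norm_sub_norm_le (f w) (Q.eval w)
      linarith [hQ w hw, hmf w (by simpa using hw)]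
    have hQ0 : ∀ w : ℂ, ‖w‖ ≤ 1 → Q.eval w ≠ 0 := fun w hw =>
      norm_pos_iff.mp ((half_pos hm).trans (hQ' w hw))
    obtain ⟨k, hk, hk0⟩ := exists_hasWindingNumber_eval Q fun w hw => hQ0 w hw.le
    rw [hk0.mpr hQ0, Nat.cast_zero, neg_zero] at hk
    exact hk.of_norm_sub_lt (hcQ _) hcf (by simp only [clockwise_zero, clockwise_two_pi])
      (by simp only [clockwise_zero, clockwise_two_pi]) fun θ _ =>
        (hQ _ (norm_clockwise θ).le).trans (hQ' _ (norm_clockwise θ).le)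

theorem exists_polynomial_near_seriesEval {f : PowerSeries ℂ} (hf : f ∈ wienerSubalgebra) {ε : ℝ}
    (hε : 0 < ε) : ∃ Q : Polynomial ℂ, ∀ w : ℂ, ‖w‖ ≤ 1 → ‖seriesEval f w - Q.eval w‖ < ε := by
  have hf' := mem_wienerSubalgebra.mp hf
  have ht := tendsto_sum_nat_add fun n => ‖PowerSeries.coeff n f‖
  obtain ⟨N, hN⟩ := (ht.eventually (gt_mem_nhds hε)).exists
  refine ⟨PowerSeries.trunc N f, fun w hw => lt_of_le_of_lt ?_ hN⟩
  have hs := summable_norm_coeff_mul_pow hf hw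
  have h1 : (PowerSeries.trunc N f).eval w =
      ∑ n ∈ Finset.range N, PowerSeries.coeff n f * w ^ n :=
    PowerSeries.eval₂_trunc_eq_sum_range w (RingHom.id ℂ) N f
  have h2 := hs.of_norm.sum_add_tsum_nat_add N
  rw [seriesEval, h1, ← h2, add_sub_cancel_left]
  have hs' : Summable fun n => ‖PowerSeries.coeff (n + N) f * w ^ (n + N)‖ :=
    (summable_nat_add_iff N).mpr hs
  have hf'' : Summable fun n => ‖PowerSeries.coeff (n + N) f‖ := (summable_nat_add_iff N).mpr hf'
  refine (norm_tsum_le_tsum_norm hs').trans (hs'.tsum_le_tsum (fun n => ?_) hf'')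
  rw [norm_mul, norm_pow]
  exact mul_le_of_le_one_right (norm_nonneg _) (pow_le_one₀ (norm_nonneg _) hw)

end TwoTermFracDiff

end Winding

/-! ### The boundary curve and its inner region -/

section Curve

open Filter Topology

namespace TwoTermFracDiff

theorem ofReal_mul_exp_cpow {r τ : ℝ} (hr : 0 ≤ r) (h1 : -Real.pi < τ) (h2 : τ ≤ Real.pi) {μ : ℝ}
    (hμ : 0 < μ) : ((r : ℂ) * Complex.exp (τ * Complex.I)) ^ (μ : ℂ) =
      ((r ^ μ : ℝ) : ℂ) * Complex.exp (Complex.I * ((μ * τ : ℝ) : ℂ)) := by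
  have hμc : (μ : ℂ) ≠ 0 := by exact_mod_cast hμ.ne'
  rcases hr.eq_or_lt with rfl | hr
  · rw [Real.zero_rpow hμ.ne', Complex.ofReal_zero, zero_mul, zero_mul, Complex.zero_cpow hμc]
  · have hr0 : (r : ℂ) ≠ 0 := by exact_mod_cast hr.ne'
    rw [Complex.cpow_def_of_ne_zero (mul_ne_zero hr0 (Complex.exp_ne_zero _)),
      Complex.log_ofReal_mul hr (Complex.exp_ne_zero _),
      Complex.log_exp (by simpa using h1) (by simpa using h2), Real.rpow_def_of_pos hr,
      Complex.ofReal_exp, ← Complex.exp_add]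
    congr 1
    push_cast
    ring

theorem one_sub_exp_neg (θ : ℝ) :
    1 - Complex.exp (-(θ * Complex.I)) = ((2 * Real.sin (θ / 2) : ℝ) : ℂ) *
      Complex.exp (((Real.pi / 2 - θ / 2 : ℝ) : ℂ) * Complex.I) := by
  have h1 : Complex.exp (((Real.pi / 2 - θ / 2 : ℝ) : ℂ) * Complex.I) =
      Complex.I * Complex.exp (-((θ / 2 : ℝ) : ℂ) * Complex.I) := by
    rw [Complex.ofReal_sub, sub_mul, sub_eq_add_neg, Complex.exp_add]
    push_cast
    rw [Complex.exp_pi_div_two_mul_I, neg_mul]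
  have h2 : Complex.exp (-(θ * Complex.I)) =
      Complex.exp (-((θ / 2 : ℝ) : ℂ) * Complex.I) * Complex.exp (-((θ / 2 : ℝ) : ℂ) * Complex.I) := by
    rw [← Complex.exp_add]
    push_cast
    ring_nf
  have h3 : Complex.exp (((θ / 2 : ℝ) : ℂ) * Complex.I) *
      Complex.exp (-((θ / 2 : ℝ) : ℂ) * Complex.I) = 1 := by
    rw [← Complex.exp_add, neg_mul, add_neg_cancel, Complex.exp_zero]
  rw [h1, h2, Complex.ofReal_mul, Complex.ofReal_sin, Complex.sin]
  push_cast at h3 ⊢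
  linear_combination (-1 + Complex.I ^ 2 + 1) * h3 +
    (1 - Complex.exp (-(θ / 2) * Complex.I) ^ 2) * Complex.I_sq

/-- For these `θ` the modulus `2 sin (θ/2)` is nonnegative and the angle `π/2 - θ/2` lies in `[-π/2,
π/2]`, within the principal range. -/
theorem one_sub_exp_neg_cpow {θ : ℝ} (hθ : θ ∈ Set.Icc 0 (2 * Real.pi)) {μ : ℝ} (hμ : 0 < μ) :
    (1 - Complex.exp (-(θ * Complex.I))) ^ (μ : ℂ) =
      ((2 ^ μ * Real.sin (θ / 2) ^ μ : ℝ) : ℂ) *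
        Complex.exp (Complex.I * ((μ * (Real.pi / 2 - θ / 2) : ℝ) : ℂ)) := by
  have hs : 0 ≤ Real.sin (θ / 2) :=
    Real.sin_nonneg_of_nonneg_of_le_pi (by linarith [hθ.1]) (by linarith [hθ.2])
  have hπ := Real.pi_pos
  rw [one_sub_exp_neg, ofReal_mul_exp_cpow (by positivity) (by linarith [hθ.2])
    (by linarith [hθ.1]) hμ, Real.mul_rpow two_pos.le hs]

variable {α β a : ℝ} {b : ℂ}

theorem charFun_exp (hβ : 0 < β) (hα : 0 < α) {θ : ℝ} (hθ : θ ∈ Set.Icc 0 (2 * Real.pi)) :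
    charFun α β a (Complex.exp ((θ : ℂ) * Complex.I)) =
      ((2 ^ α * Real.sin (θ / 2) ^ α : ℝ) : ℂ) *
          Complex.exp (Complex.I * ((α * Real.pi / 2 + θ * (2 - α / 2) : ℝ) : ℂ)) +
        (a : ℂ) * ((2 ^ β * Real.sin (θ / 2) ^ β : ℝ) : ℂ) *
          Complex.exp (Complex.I * ((β * Real.pi / 2 + θ * (1 - β / 2) : ℝ) : ℂ)) + 1 := by
  have h1 : Complex.exp (Complex.I * ((α * Real.pi / 2 + θ * (2 - α / 2) : ℝ) : ℂ)) =
      Complex.exp (θ * Complex.I) ^ 2 *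
        Complex.exp (Complex.I * ((α * (Real.pi / 2 - θ / 2) : ℝ) : ℂ)) := by
    rw [← Complex.exp_nat_mul, ← Complex.exp_add]
    push_cast
    ring_nf
  have h2 : Complex.exp (Complex.I * ((β * Real.pi / 2 + θ * (1 - β / 2) : ℝ) : ℂ)) =
      Complex.exp (θ * Complex.I) *
        Complex.exp (Complex.I * ((β * (Real.pi / 2 - θ / 2) : ℝ) : ℂ)) := by
    rw [← Complex.exp_add]
    push_cast
    ring_nf
  rw [charFun, ← Complex.exp_neg, one_sub_exp_neg_cpow hθ hα, one_sub_exp_neg_cpow hθ hβ, h1, h2]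
  ring

theorem charFun_exp_eq_boundaryCurve (hβ : 0 < β) (hα : 0 < α) {θ : ℝ}
    (hθ : θ ∈ Set.Icc 0 (2 * Real.pi)) :
    charFun α β a (Complex.exp ((θ : ℂ) * Complex.I)) = boundaryCurve α β a θ := by
  have hexp : ∀ t : ℝ, Complex.exp (Complex.I * (t : ℂ)) = ⟨Real.cos t, Real.sin t⟩ := fun t => by
    rw [mul_comm, Complex.exp_mul_I, ← Complex.ofReal_cos, ← Complex.ofReal_sin]
    exact (Complex.mk_eq_add_mul_I _ _).symm
  rw [charFun_exp hβ hα hθ, hexp, hexp, ← Complex.ofReal_mul]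
  apply Complex.ext
  · simp only [Complex.add_re, Complex.re_ofReal_mul, Complex.one_re, boundaryCurve, boundaryRe]
    ring
  · simp only [Complex.add_im, Complex.im_ofReal_mul, Complex.one_im, boundaryCurve, boundaryIm]
    ring

theorem boundaryCurve_zero_eq (hβ : 0 < β) (hα : 0 < α) :
    boundaryCurve α β a 0 = boundaryCurve α β a (2 * Real.pi) := by
  have h : (2 * Real.pi) / 2 = Real.pi := by ring
  simp [boundaryCurve, boundaryRe, boundaryIm, h, Real.zero_rpow hα.ne', Real.zero_rpow hβ.ne']

theorem continuous_boundaryCurve (hβ : 0 < β) (hα : 0 < α) :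
    Continuous (boundaryCurve α β a) := by
  have hs : ∀ μ : ℝ, 0 < μ → Continuous fun θ : ℝ => Real.sin (θ / 2) ^ μ := fun μ hμ =>
    Continuous.rpow_const (by fun_prop) fun _ => Or.inr hμ.le
  have h1 := hs α hα
  have h2 := hs β hβ
  have hre : Continuous (boundaryRe α β a) := by
    unfold boundaryRe
    fun_prop
  have him : Continuous (boundaryIm α β a) := by
    unfold boundaryIm
    fun_prop
  have h : boundaryCurve α β a =
      fun θ => (boundaryRe α β a θ : ℂ) + (boundaryIm α β a θ : ℂ) * Complex.I :=
    funext fun θ => Complex.mk_eq_add_mul_I _ _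
  rw [h]
  fun_prop

/-- On the circle `charVal` is the curve minus `b`, times `e^(-2iθ)`; this factor shifts the winding
number by two. -/
theorem hasWindingNumber_boundaryCurve_iff (hβ0 : 0 < β) (hβ1 : β ≤ 1) (hα1 : 1 < α)
    (hα2 : α ≤ 2) :
    HasWindingNumber (boundaryCurve α β a) b 2 ↔ AsymptoticallyStable α β a b := by
  have hP := charSeries_mem_wienerSubalgebra hβ0 hβ1 hα1 hα2 a b
  have he : ∀ w ∈ Metric.closedBall (0 : ℂ) 1,
      charVal α β a b w = seriesEval (charSeries α β a b) w := fun w hw =>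
    (hasEval_charSeries hβ0 hβ1 hα1 hα2 a b (by simpa using hw)).2.symm
  have hiff := hasWindingNumber_zero_iff_ne_zero (f := charVal α β a b)
    ((continuousOn_seriesEval hP).congr he) fun ε hε => by
      obtain ⟨Q, hQ⟩ := exists_polynomial_near_seriesEval hP hε
      refine ⟨Q, fun w hw => ?_⟩
      rw [he w (by simpa using hw)]
      exact hQ w hw
  have hz : ∀ θ : ℝ, clockwise θ = (Complex.exp (θ * Complex.I))⁻¹ := fun θ => by
    rw [clockwise, Complex.exp_neg]
  have hcurve : ∀ θ ∈ Set.Icc 0 (2 * Real.pi), charVal α β a b (clockwise θ) =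
      (boundaryCurve α β a θ - b) * Complex.exp ((-2 : ℤ) * (θ * Complex.I)) := fun θ hθ => by
    rw [hz, charVal_inv (Complex.exp_ne_zero _),
      charFun_exp_eq_boundaryCurve hβ0 (by linarith) hθ, Complex.exp_int_mul, mul_comm,
      zpow_neg, inv_pow]
    norm_cast
  rw [asymptoticallyStable_iff_charVal_ne_zero hβ0 hβ1 hα1 hα2, ← hiff,
    HasWindingNumber.sub_iff]
  constructor
  · intro h
    exact (h.mul (HasWindingNumber.exp_int_mul (-2))).congr fun θ hθ => (hcurve θ hθ).symm
  · intro h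
    have h2 := h.mul (HasWindingNumber.exp_int_mul 2)
    rw [zero_add] at h2
    refine h2.congr fun θ hθ => ?_
    simp only [hcurve θ hθ]
    rw [mul_assoc, ← Complex.exp_add]
    push_cast
    rw [neg_mul, neg_add_cancel, Complex.exp_zero, mul_one]

theorem frontier_asymptoticallyStable_subset (hβ0 : 0 < β) (hβ1 : β ≤ 1) (hα1 : 1 < α)
    (hα2 : α ≤ 2) :
    frontier {b : ℂ | AsymptoticallyStable α β a b} ⊆
      boundaryCurve α β a '' Set.Icc 0 (2 * Real.pi) := by
  have hα0 : 0 < α := by linarith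
  have hc := continuous_boundaryCurve (a := a) hβ0 hα0
  have h0 := boundaryCurve_zero_eq (a := a) hβ0 hα0
  intro b hb
  by_contra hn
  have hK : IsClosed (boundaryCurve α β a '' Set.Icc 0 (2 * Real.pi)) :=
    (isCompact_Icc.image hc).isClosed
  obtain ⟨d, hd, hball⟩ := Metric.isOpen_iff.mp hK.isOpen_compl b hn
  have hfar : ∀ θ ∈ Set.Icc 0 (2 * Real.pi), d ≤ ‖boundaryCurve α β a θ - b‖ := fun θ hθ => by
    by_contra hlt
    exact hball (by simpa [dist_eq_norm] using hlt) ⟨θ, hθ, rfl⟩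
  have htransfer : ∀ b₁ b₂ : ℂ, (∀ θ ∈ Set.Icc 0 (2 * Real.pi),
      ‖b₁ - b₂‖ < ‖boundaryCurve α β a θ - b₁‖) →
      AsymptoticallyStable α β a b₁ → AsymptoticallyStable α β a b₂ := fun b₁ b₂ h hs => by
    rw [← hasWindingNumber_boundaryCurve_iff hβ0 hβ1 hα1 hα2, HasWindingNumber.sub_iff] at hs ⊢
    refine hs.of_norm_sub_lt (by fun_prop) (by fun_prop) (by rw [h0]) (by rw [h0]) fun θ hθ => ?_
    rw [sub_sub_sub_cancel_left]
    exact h θ hθ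
  -- Radius `d / 2` keeps `b'` farther than `d / 2` from the curve, so Rouché works in both
  -- directions.
  have hiff : ∀ b' ∈ Metric.ball b (d / 2),
      (AsymptoticallyStable α β a b' ↔ AsymptoticallyStable α β a b) := fun b' hb' => by
    have hb'd : ‖b' - b‖ < d / 2 := by simpa [dist_eq_norm] using hb'
    refine ⟨htransfer b' b fun θ hθ => ?_, htransfer b b' fun θ hθ => ?_⟩
    · have h1 := norm_add_le (boundaryCurve α β a θ - b') (b' - b)
      rw [sub_add_sub_cancel] at h1
      linarith [hfar θ hθ]
    · rw [norm_sub_rev]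
      linarith [hfar θ hθ]
  have hnhds := Metric.ball_mem_nhds b (half_pos hd)
  obtain ⟨b', hb', hs'⟩ := mem_closure_iff_nhds.mp hb.1 _ hnhds
  exact hb.2 (mem_interior_iff_mem_nhds.mpr (mem_of_superset hnhds fun b'' hb'' =>
    (hiff b'' hb'').mpr ((hiff b' hb').mp hs')))

end TwoTermFracDiff

end Curve

open TwoTermFracDiff in
theorem mainTheorem1 (α β a : ℝ) (hβ0 : 0 < β) (hβ1 : β ≤ 1) (hα1 : 1 < α) (hα2 : α ≤ 2) :
    -- the Z-transform of a solution exists near infinity and satisfies the transformed equation,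
    -- whose coefficient of `X(z)` is the characteristic function
    (∀ (b : ℂ) (x : ℕ → ℂ), IsSolution α β a b x →
      (∃ R : ℝ, ∀ z : ℂ, R < ‖z‖ → Summable fun n : ℕ => x n * (z⁻¹) ^ n) ∧
      ∀ z : ℂ, 1 < ‖z‖ → (Summable fun n : ℕ => x n * (z⁻¹) ^ n) →
        (charFun α β a z - b) * zTransform x z =
          (z * (z - 2) * (z / (z - 1)) ^ ((2 - α : ℝ) : ℂ) +
            (a : ℂ) * z * (z / (z - 1)) ^ ((1 - β : ℝ) : ℂ)) * x 0 +
          z * (z / (z - 1)) ^ ((2 - α : ℝ) : ℂ) * x 1) ∧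
    -- stability is governed by the roots of the characteristic equation
    (∀ b : ℂ, AsymptoticallyStable α β a b ↔ ∀ z : ℂ, z ≠ 0 → charFun α β a z = b → ‖z‖ < 1) ∧
    -- the value of `b` for `z = exp (iθ)`, its real and imaginary parts
    (∀ θ ∈ Set.Icc 0 (2 * Real.pi),
      charFun α β a (Complex.exp ((θ : ℂ) * Complex.I)) =
        ((2 ^ α * Real.sin (θ / 2) ^ α : ℝ) : ℂ) *
            Complex.exp (Complex.I * ((α * Real.pi / 2 + θ * (2 - α / 2) : ℝ) : ℂ)) +
          (a : ℂ) * ((2 ^ β * Real.sin (θ / 2) ^ β : ℝ) : ℂ) *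
            Complex.exp (Complex.I * ((β * Real.pi / 2 + θ * (1 - β / 2) : ℝ) : ℂ)) + 1 ∧
      (charFun α β a (Complex.exp ((θ : ℂ) * Complex.I))).re = boundaryRe α β a θ ∧
      (charFun α β a (Complex.exp ((θ : ℂ) * Complex.I))).im = boundaryIm α β a θ) ∧
    boundaryCurve α β a 0 = boundaryCurve α β a (2 * Real.pi) ∧
    -- the stable region is bounded by the curve, and is exactly the region enclosed by it with
    -- winding number two
    frontier {b : ℂ | AsymptoticallyStable α β a b} ⊆
      boundaryCurve α β a '' Set.Icc 0 (2 * Real.pi) ∧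
    ∀ b : ℂ, HasWindingNumber (boundaryCurve α β a) b 2 ↔ AsymptoticallyStable α β a b :=
  have hα0 : 0 < α := by linarith
  ⟨fun _ _ hx => ⟨hx.exists_summable hβ0 hβ1 hα1 hα2,
      fun _ hz hs => hx.zTransform_eq hβ0 hβ1 hα1 hα2 hz hs⟩,
    fun _ => asymptoticallyStable_iff_roots hβ0 hβ1 hα1 hα2,
    fun θ hθ => ⟨charFun_exp hβ0 hα0 hθ,
      congrArg Complex.re (charFun_exp_eq_boundaryCurve hβ0 hα0 hθ),
      congrArg Complex.im (charFun_exp_eq_boundaryCurve hβ0 hα0 hθ)⟩,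
    boundaryCurve_zero_eq hβ0 hα0, frontier_asymptoticallyStable_subset hβ0 hβ1 hα1 hα2,
    fun _ => hasWindingNumber_boundaryCurve_iff hβ0 hβ1 hα1 hα2⟩
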